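/- Let $(A,\mathfrak m)$ be a Noetherian local ring of Krull dimension two that is Cohen-Macaulay and whose associated graded ring $G(A)=\bigoplus_{n\ge 0}\mathfrak m^n/\mathfrak m^{n+1}$ is Cohen-Macaulay. Assume that $A$ is not an isolated singularity, i.e. there is a prime ideal $P\neq\mathfrak m$ such that the local ring $A_P$ is not regular. Then there exists a maximal Cohen-Macaulay $A$-module $M$ (a finitely generated Cohen-Macaulay $A$-module with $\dim M=\dim A$) such that the associated graded module $G(M)=\bigoplus_{n\ge 0}\mathfrak m^nM/\mathfrak m^{n+1}M$ is a Cohen-Macaulay $G(A)$-module and $\dim_A \operatorname{Ext}^1_A(M,M)\ge 1$, where the dimension is the Krull dimension of the support. -/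

import Mathlib

universe u v

open DirectSum

noncomputable section

namespace AssocGraded

variable {A : Type u} [CommRing A] (I : Ideal A) (M : Type v) [AddCommGroup M] [Module A M]

/-- The submodule `I ^ n M` of `M`. -/
abbrev powSMul (n : ℕ) : Submodule A M := I ^ n • (⊤ : Submodule A M)

/-- The `n`-th homogeneous component `I ^ n M / I ^ (n + 1) M`. -/
abbrev Piece (n : ℕ) : Type v :=
  ↥(powSMul I M n) ⧸ (powSMul I M (n + 1)).submoduleOf (powSMul I M n)

variable {M}

/-- The class in `I ^ n M / I ^ (n + 1) M` of an element of `I ^ n M`. -/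
def mk (n : ℕ) (x : M) (hx : x ∈ powSMul I M n) : Piece I M n :=
  Submodule.Quotient.mk ⟨x, hx⟩

variable {I}

theorem smul_mem_powSMul {i j : ℕ} {a : A} {x : M} (ha : a ∈ powSMul I A i)
    (hx : x ∈ powSMul I M j) : a • x ∈ powSMul I M (i + j) := by
  have ha' : a ∈ I ^ i := by simpa using ha
  rw [powSMul, pow_add, mul_smul]
  exact Submodule.smul_mem_smul ha' hx

variable (I M)

/-- The product `I ^ i × I ^ j M → I ^ (i + j) M`. -/
def preSMul (i j : ℕ) : ↥(powSMul I A i) →ₗ[A] ↥(powSMul I M j) →ₗ[A] ↥(powSMul I M (i + j)) :=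
  LinearMap.mk₂ A (fun a x => ⟨(a : A) • (x : M), smul_mem_powSMul a.2 x.2⟩)
    (fun a b x => Subtype.ext (add_smul (a : A) (b : A) (x : M)))
    (fun c a x => Subtype.ext (smul_assoc c (a : A) (x : M)))
    (fun a x y => Subtype.ext (smul_add (a : A) (x : M) (y : M)))
    (fun c a x => Subtype.ext (smul_comm (a : A) c (x : M)))

/-- The product `I ^ i / I ^ (i + 1) × I ^ j M / I ^ (j + 1) M → I ^ (i + j) M / I ^ (i + j + 1) M`
induced by the scalar multiplication of `M`. -/
def pieceSMul (i j : ℕ) : Piece I A i →ₗ[A] Piece I M j →ₗ[A] Piece I M (i + j) :=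
  Submodule.liftQ _
    { toFun := fun a => Submodule.mapQ _ _ (preSMul I M i j a) (by
        intro x hx
        exact smul_mem_powSMul (I := I) (i := i) (j := j + 1) a.2 hx)
      map_add' := fun a b => by
        refine LinearMap.ext fun x => ?_
        obtain ⟨x, rfl⟩ := Submodule.Quotient.mk_surjective _ x
        exact congrArg Submodule.Quotient.mk (LinearMap.map_add₂ (preSMul I M i j) a b x)
      map_smul' := fun c a => by
        refine LinearMap.ext fun x => ?_
        obtain ⟨x, rfl⟩ := Submodule.Quotient.mk_surjective _ x
        exact congrArg Submodule.Quotient.mk (LinearMap.map_smul₂ (preSMul I M i j) c a x) }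
    (by
      intro a ha
      refine LinearMap.ext fun x => ?_
      obtain ⟨x, rfl⟩ := Submodule.Quotient.mk_surjective _ x
      refine (Submodule.Quotient.mk_eq_zero _).2 ?_
      have h := smul_mem_powSMul (I := I) (i := i + 1) (j := j) ha x.2
      rw [show i + 1 + j = i + j + 1 by omega] at h
      exact h)

variable {I M}

theorem exists_mk {n : ℕ} (y : Piece I M n) : ∃ x hx, y = mk I n x hx := by
  obtain ⟨⟨x, hx⟩, rfl⟩ := Submodule.Quotient.mk_surjective _ y
  exact ⟨x, hx, rfl⟩

theorem pieceSMul_mk {i j : ℕ} {a : A} {x : M} (ha : a ∈ powSMul I A i)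
    (hx : x ∈ powSMul I M j) :
    pieceSMul I M i j (mk I i a ha) (mk I j x hx) =
      mk I (i + j) (a • x) (smul_mem_powSMul ha hx) := rfl

theorem gradedMk_eq {i j : ℕ} (h : i = j) {x y : M} (hxy : x = y) (hx : x ∈ powSMul I M i)
    (hy : y ∈ powSMul I M j) :
    (GradedMonoid.mk i (mk I i x hx) : GradedMonoid (Piece I M)) =
      GradedMonoid.mk j (mk I j y hy) := by
  subst h; subst hxy; rfl

theorem one_mem_powSMul : (1 : A) ∈ powSMul I A 0 := by simp

instance : GradedMonoid.GMul (Piece I A) where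
  mul a b := pieceSMul I A _ _ a b

instance : GradedMonoid.GOne (Piece I A) where
  one := mk I 0 1 one_mem_powSMul

instance : GradedMonoid.GMonoid (Piece I A) where
  one_mul := by
    rintro ⟨i, a⟩
    obtain ⟨a, ha, rfl⟩ := exists_mk a
    exact gradedMk_eq (zero_add i) (one_smul A a) _ _
  mul_one := by
    rintro ⟨i, a⟩
    obtain ⟨a, ha, rfl⟩ := exists_mk a
    exact gradedMk_eq (add_zero i) (mul_one a) _ _
  mul_assoc := by
    rintro ⟨i, a⟩ ⟨j, b⟩ ⟨k, c⟩
    obtain ⟨a, ha, rfl⟩ := exists_mk a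
    obtain ⟨b, hb, rfl⟩ := exists_mk b
    obtain ⟨c, hc, rfl⟩ := exists_mk c
    exact gradedMk_eq (add_assoc i j k) (mul_assoc a b c) _ _

instance : DirectSum.GCommRing (Piece I A) where
  mul_zero a := map_zero (pieceSMul I A _ _ a)
  zero_mul b := by
    change pieceSMul I A _ _ 0 b = 0
    simp
  mul_add a b c := map_add (pieceSMul I A _ _ a) b c
  add_mul a b c := by
    change pieceSMul I A _ _ (a + b) c = pieceSMul I A _ _ a c + pieceSMul I A _ _ b c
    simp
  natCast n := n • mk I 0 1 one_mem_powSMul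
  natCast_zero := zero_nsmul _
  natCast_succ n := succ_nsmul _ n
  intCast n := n • mk I 0 1 one_mem_powSMul
  intCast_ofNat n := natCast_zsmul _ n
  intCast_negSucc_ofNat n := negSucc_zsmul _ n
  mul_comm := by
    rintro ⟨i, a⟩ ⟨j, b⟩
    obtain ⟨a, ha, rfl⟩ := exists_mk a
    obtain ⟨b, hb, rfl⟩ := exists_mk b
    exact gradedMk_eq (add_comm i j) (mul_comm a b) _ _

instance : DirectSum.Gmodule (Piece I A) (Piece I M) where
  smul a x := pieceSMul I M _ _ a x
  one_smul := by
    rintro ⟨i, x⟩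
    obtain ⟨x, hx, rfl⟩ := exists_mk x
    exact gradedMk_eq (zero_add i) (one_smul A x) _ _
  mul_smul := by
    rintro ⟨i, a⟩ ⟨j, b⟩ ⟨k, x⟩
    obtain ⟨a, ha, rfl⟩ := exists_mk a
    obtain ⟨b, hb, rfl⟩ := exists_mk b
    obtain ⟨x, hx, rfl⟩ := exists_mk x
    exact gradedMk_eq (add_assoc i j k) (mul_smul a b x) _ _
  smul_add a x y := map_add (pieceSMul I M _ _ a) x y
  smul_zero a := map_zero (pieceSMul I M _ _ a)
  add_smul a b x := by
    change pieceSMul I M _ _ (a + b) x = pieceSMul I M _ _ a x + pieceSMul I M _ _ b x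
    simp
  zero_smul x := by
    change pieceSMul I M _ _ 0 x = 0
    simp

end AssocGraded

/-- The associated graded ring `⨁ n, I ^ n / I ^ (n + 1)` of `A` with respect to `I`. -/
def AssocGradedRing {A : Type u} [CommRing A] (I : Ideal A) : Type u :=
  ⨁ n, AssocGraded.Piece I A n

instance {A : Type u} [CommRing A] (I : Ideal A) : CommRing (AssocGradedRing I) :=
  inferInstanceAs (CommRing (⨁ n, AssocGraded.Piece I A n))

/-- The associated graded module `⨁ n, I ^ n M / I ^ (n + 1) M` of `M` with respect to `I`. -/
def AssocGradedModule {A : Type u} [CommRing A] (I : Ideal A) (M : Type v) [AddCommGroup M]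
    [Module A M] : Type v :=
  ⨁ n, AssocGraded.Piece I M n

instance {A : Type u} [CommRing A] (I : Ideal A) (M : Type v) [AddCommGroup M] [Module A M] :
    AddCommGroup (AssocGradedModule I M) :=
  inferInstanceAs (AddCommGroup (⨁ n, AssocGraded.Piece I M n))

instance {A : Type u} [CommRing A] (I : Ideal A) (M : Type v) [AddCommGroup M] [Module A M] :
    Module (AssocGradedRing I) (AssocGradedModule I M) :=
  inferInstanceAs (Module (⨁ n, AssocGraded.Piece I A n) (⨁ n, AssocGraded.Piece I M n))

/-- The depth of a module over a local ring: the supremum of the lengths of the regular sequences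
on `M` that lie in the maximal ideal. -/
def localDepth (R : Type u) [CommRing R] [IsLocalRing R] (M : Type v) [AddCommGroup M]
    [Module R M] : ℕ∞ :=
  ⨆ (rs : List R) (_ : ∀ r ∈ rs, r ∈ IsLocalRing.maximalIdeal R)
    (_ : RingTheory.Sequence.IsRegular M rs), (rs.length : ℕ∞)

/-- A finitely generated module over a Noetherian local ring is Cohen-Macaulay if it is zero or
its depth equals its dimension. -/
def IsLocalCohenMacaulay (R : Type u) [CommRing R] [IsLocalRing R] (M : Type v) [AddCommGroup M]
    [Module R M] : Prop :=
  Nontrivial M → (localDepth R M : WithBot ℕ∞) = Module.supportDim R M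

/-- A finitely generated module over a Noetherian ring is Cohen-Macaulay if its localizations at
all maximal ideals are Cohen-Macaulay. A ring is Cohen-Macaulay if it is so as a module over
itself. -/
def IsCohenMacaulay (R : Type u) [CommRing R] (M : Type v) [AddCommGroup M] [Module R M] : Prop :=
  ∀ (p : Ideal R) [p.IsMaximal],
    IsLocalCohenMacaulay (Localization.AtPrime p) (LocalizedModule p.primeCompl M)

/-- A maximal Cohen-Macaulay module over a Noetherian local ring: a finitely generated
Cohen-Macaulay module of dimension `dim A`. -/
structure IsMaximalCohenMacaulay (A : Type u) [CommRing A] [IsLocalRing A] (M : Type v)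
    [AddCommGroup M] [Module A M] : Prop where
  finite : Module.Finite A M
  cohenMacaulay : IsLocalCohenMacaulay A M
  dim_eq : Module.supportDim A M = ringKrullDim A

/-- A Noetherian local ring is an isolated singularity if its localizations at all non-maximal
primes are regular (regular local rings are included). -/
def IsIsolatedSingularity (A : Type u) [CommRing A] [IsLocalRing A] : Prop :=
  ∀ (p : Ideal A) [p.IsPrime], p ≠ IsLocalRing.maximalIdeal A →
    IsRegularLocalRing (Localization.AtPrime p)

end

/-! Choose a prime P ≠ m with A_P not regular, and let M be the kernel of a minimal free cover F =
A^s → Q of Q = m^n(A/P), with n large. An element of m outside P is regular on Q, so M is a first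
syzygy of a module of positive depth over a Cohen-Macaulay ring of dimension two, hence maximal
Cohen-Macaulay (`localDepth_and_supportDim_of_syzygy`).

The same argument is run over G(A). For large n the relations of Q are linear up to higher order, so
M ∩ m^(j+1)F = m^j M (`Ideal.exists_forall_ker_inf_pow_succ_eq`), and 0 → G(M)(-1) → G(A)^s → G(Q) →
0 is exact. For large n, moreover, G(Q) has no homogeneous socle
(`Ideal.exists_forall_mem_pow_succ_smul_of_forall_smul_mem`), hence no maximal ideal of G(A) is
associated to it. Since dim G(A) ≤ 2, by Noether normalization and the quadratic growth of the
length of A/m^n, G(M) is Cohen-Macaulay (`IsCohenMacaulay.of_syzygy`).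

Finally P lies in the support of Ext¹(M, M), and P < m is then a chain of length one. At P, Q
becomes the residue field of A_P and M becomes PA_P plus a free module. If Ext¹(M, M) vanished at P,
a nonzero map P → A/P would produce a map P → A with a value outside P, making PA_P principal on a
nonzerodivisor; if there is no nonzero map P → A/P, then PA_P = 0. In both cases A_P is regular
(`mem_support_ext_of_not_isRegularLocalRing`). -/

/-! ### Depth, regular sequences and syzygies over local rings. -/

open IsLocalRing in
-- The hypothesis says Hom(R/m, L) = 0, since a map from R/m is determined by its value at 1; for
-- finite modules over a Noetherian ring this vanishing is equivalent to the annihilator m of R/m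
-- containing an L-regular element.
theorem exists_isSMulRegular_of_forall_eq_zero {R : Type*} [CommRing R] [IsLocalRing R]
    [IsNoetherianRing R] {L : Type*} [AddCommGroup L] [Module R L] [Module.Finite R L]
    (h : ∀ t : L, (∀ a ∈ maximalIdeal R, a • t = 0) → t = 0) :
    ∃ r ∈ maximalIdeal R, IsSMulRegular L r := by
  have hs : Subsingleton ((R ⧸ maximalIdeal R) →ₗ[R] L) := by
    refine subsingleton_of_forall_eq 0 fun f => ?_
    have h1 : f 1 = 0 := h _ fun a ha => by
      rw [← map_smul, Algebra.smul_def, mul_one]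
      rw [Ideal.Quotient.algebraMap_eq, Ideal.Quotient.eq_zero_iff_mem.2 ha, map_zero]
    ext
    simpa using h1
  obtain ⟨r, hr, hreg⟩ := IsSMulRegular.subsingleton_linearMap_iff.1 hs
  rw [Ideal.annihilator_quotient] at hr
  exact ⟨r, hr, hreg⟩

open scoped Pointwise in
-- Elementwise form of regularity modulo x, which lets the depth arguments below be carried out by
-- cancellation.
theorem isSMulRegular_quotSMulTop_iff {R : Type*} [CommRing R] {L : Type*} [AddCommGroup L]
    [Module R L] (x y : R) :
    IsSMulRegular (QuotSMulTop x L) y ↔ ∀ u v : L, y • u = x • v → ∃ w, u = x • w := by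
  change IsSMulRegular (L ⧸ x • (⊤ : Submodule R L)) y ↔ _
  rw [isSMulRegular_quotient_iff_mem_of_smul_mem]
  simp only [Submodule.mem_smul_pointwise_iff_exists, Submodule.mem_top, true_and]
  constructor
  · intro h u v huv
    obtain ⟨w, hw⟩ := h u ⟨v, huv.symm⟩
    exact ⟨w, hw.symm⟩
  · rintro h u ⟨v, hv⟩
    obtain ⟨w, hw⟩ := h u v hv.symm
    exact ⟨w, hw.symm⟩

open IsLocalRing RingTheory.Sequence in
theorem isRegular_singleton_of_isSMulRegular {R : Type*} [CommRing R] [IsLocalRing R]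
    [IsNoetherianRing R] {L : Type*} [AddCommGroup L] [Module R L] [Module.Finite R L]
    [Nontrivial L] {x : R} (hx : x ∈ maximalIdeal R) (h : IsSMulRegular L x) :
    IsRegular L [x] := by
  refine IsRegular.of_isWeaklyRegular_of_mem_maximalIdeal _ ?_
    ((isWeaklyRegular_singleton_iff L x).2 h)
  simpa using hx

open IsLocalRing RingTheory.Sequence in
theorem isRegular_pair_of_isSMulRegular {R : Type*} [CommRing R] [IsLocalRing R]
    [IsNoetherianRing R] {L : Type*} [AddCommGroup L] [Module R L] [Module.Finite R L]
    [Nontrivial L] {x y : R} (hx : x ∈ maximalIdeal R) (hy : y ∈ maximalIdeal R)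
    (h : IsSMulRegular L x) (h' : IsSMulRegular (QuotSMulTop x L) y) :
    IsRegular L [x, y] := by
  refine IsRegular.of_isWeaklyRegular_of_mem_maximalIdeal _ ?_
    (IsWeaklyRegular.cons h ((isWeaklyRegular_singleton_iff _ y).2 h'))
  rintro r hr
  rcases List.mem_pair.1 hr with rfl | rfl <;> assumption

open IsLocalRing RingTheory.Sequence in
theorem le_localDepth {R : Type u} [CommRing R] [IsLocalRing R] {L : Type v} [AddCommGroup L]
    [Module R L] {rs : List R} (h : ∀ r ∈ rs, r ∈ maximalIdeal R) (hreg : IsRegular L rs) :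
    (rs.length : ℕ∞) ≤ localDepth R L :=
  le_iSup₂_of_le rs h (le_iSup_of_le hreg le_rfl)

open RingTheory.Sequence in
theorem length_le_supportDim_of_isRegular {R : Type*} [CommRing R] [IsLocalRing R]
    [IsNoetherianRing R] {L : Type*} [AddCommGroup L] [Module R L] [Module.Finite R L]
    {rs : List R} (hreg : IsRegular L rs) :
    ((rs.length : ℕ∞) : WithBot ℕ∞) ≤ Module.supportDim R L := by
  have h := Module.supportDim_add_length_eq_supportDim_of_isRegular rs hreg
  have hne : Nontrivial (L ⧸ Ideal.ofList rs • (⊤ : Submodule R L)) :=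
    hreg.quot_ofList_smul_nontrivial ⊤
  obtain ⟨e, he⟩ := WithBot.ne_bot_iff_exists.1 (Module.supportDim_ne_bot_of_nontrivial R
    (L ⧸ Ideal.ofList rs • (⊤ : Submodule R L)))
  rw [← he] at h
  rw [← h]
  change _ ≤ ((e + (rs.length : ℕ∞) : ℕ∞) : WithBot ℕ∞)
  exact WithBot.coe_le_coe.2 le_add_self

open RingTheory.Sequence in
theorem localDepth_le_supportDim (R : Type u) [CommRing R] [IsLocalRing R] [IsNoetherianRing R]
    (L : Type v) [AddCommGroup L] [Module R L] [Module.Finite R L] [Nontrivial L] :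
    (localDepth R L : WithBot ℕ∞) ≤ Module.supportDim R L := by
  obtain ⟨d, hd⟩ := WithBot.ne_bot_iff_exists.1 (Module.supportDim_ne_bot_of_nontrivial R L)
  rw [← hd, WithBot.coe_le_coe]
  refine iSup₂_le fun rs hrs => iSup_le fun hreg => ?_
  have h := length_le_supportDim_of_isRegular hreg
  rwa [← hd, WithBot.coe_le_coe] at h

open IsLocalRing RingTheory.Sequence in
-- A finite supremum of natural numbers is attained; the empty sequence, regular because L ≠ 0,
-- excludes an empty supremum.
theorem exists_isRegular_length_of_localDepth_eq {R : Type u} [CommRing R] [IsLocalRing R]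
    {L : Type v} [AddCommGroup L] [Module R L] [Nontrivial L] {n : ℕ} (h : localDepth R L = n) :
    ∃ rs : List R, (∀ r ∈ rs, r ∈ maximalIdeal R) ∧ IsRegular L rs ∧ rs.length = n := by
  by_contra! hcon
  have hlt : ∀ rs : List R, (∀ r ∈ rs, r ∈ maximalIdeal R) → IsRegular L rs → rs.length < n := by
    intro rs h1 h2
    have := le_localDepth h1 h2
    rw [h] at this
    exact lt_of_le_of_ne (by exact_mod_cast this) (hcon rs h1 h2)
  have hpos := hlt [] (by simp) (IsRegular.nil R L)
  have hle : localDepth R L ≤ ((n - 1 : ℕ) : ℕ∞) := by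
    refine iSup₂_le fun rs hrs => iSup_le fun hreg => ?_
    have := hlt rs hrs hreg
    exact_mod_cast (by omega : rs.length ≤ n - 1)
  rw [h] at hle
  have : n ≤ n - 1 := by exact_mod_cast hle
  simp at hpos
  omega

/-- If `x, y` is a regular sequence in `m` and `r` is a nonzerodivisor, then no nonzero element of
`R / r` is annihilated by `m`. -/
theorem exists_eq_mul_of_forall_mul_mem {R : Type*} [CommRing R] {m : Ideal R}
    {x y r : R} (hx : x ∈ m) (hy : y ∈ m)
    (hxr : IsSMulRegular R x) (hyr : IsSMulRegular (QuotSMulTop x R) y) (hr : IsSMulRegular R r)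
    {u : R} (hu : ∀ a ∈ m, ∃ c, a * u = r * c) : ∃ c, u = r * c := by
  obtain ⟨v, hv⟩ := hu x hx
  obtain ⟨c, hc⟩ := hu y hy
  rw [isSMulRegular_quotSMulTop_iff] at hyr
  -- From xu = rv and yu = rc one gets r(yv) = r(xc); cancelling r gives yv = xc, so v = xw.
  obtain ⟨w, hw⟩ := hyr v c (hr (by
    simp only [smul_eq_mul]
    rw [mul_left_comm, ← hv, mul_left_comm, hc, mul_left_comm]))
  refine ⟨w, hxr ?_⟩
  simp only [smul_eq_mul] at hw ⊢
  rw [hv, hw, mul_left_comm]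

open IsLocalRing RingTheory.Sequence in
/-- Over a Cohen-Macaulay local ring of dimension at most two, the first syzygy of a module to
which the maximal ideal is not associated is maximal Cohen-Macaulay. -/
theorem localDepth_and_supportDim_of_syzygy {R : Type u} [CommRing R] [IsLocalRing R]
    [IsNoetherianRing R] (hR : IsLocalCohenMacaulay R R) (hdim : ringKrullDim R ≤ 2)
    {ι : Type*} [Finite ι] {K : Type v} [AddCommGroup K] [Module R K] [Nontrivial K]
    {T : Type*} [AddCommGroup T] [Module R T] (f : K →ₗ[R] (ι → R)) (g : (ι → R) →ₗ[R] T)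
    (hf : Function.Injective f) (hfg : Function.Exact f g) (hg : Function.Surjective g)
    (hT : ∀ t : T, (∀ a ∈ maximalIdeal R, a • t = 0) → t = 0) :
    (localDepth R K : WithBot ℕ∞) = ringKrullDim R ∧
      Module.supportDim R K = ringKrullDim R := by
  have hfin : Module.Finite R K := Module.Finite.of_injective f hf
  have hfinT : Module.Finite R T := Module.Finite.of_surjective g hg
  suffices h : ringKrullDim R ≤ (localDepth R K : WithBot ℕ∞) from
    ⟨le_antisymm ((localDepth_le_supportDim R K).trans (Module.supportDim_le_ringKrullDim R K)) h,
      le_antisymm (Module.supportDim_le_ringKrullDim R K)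
        (h.trans (localDepth_le_supportDim R K))⟩
  have hRd := hR inferInstance
  rw [Module.supportDim_self_eq_ringKrullDim] at hRd
  rw [← hRd] at hdim ⊢
  rw [WithBot.coe_le_coe]
  have h2 : localDepth R R ≤ ((2 : ℕ) : ℕ∞) :=
    WithBot.coe_le_coe.1 hdim
  obtain ⟨d, hd⟩ := ENat.ne_top_iff_exists.1 (ne_top_of_le_ne_top (ENat.natCast_ne_top 2) h2)
  obtain ⟨rs, hrs, hreg, hlen⟩ := exists_isRegular_length_of_localDepth_eq hd.symm
  rw [← hd] at h2 ⊢
  have hd2 : d ≤ 2 := by exact_mod_cast h2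
  have hregK : ∀ r : R, IsSMulRegular R r → IsSMulRegular K r := fun r hr =>
    (IsSMulRegular.pi fun _ => hr : IsSMulRegular (ι → R) r).of_injective f hf
  interval_cases d
  · simp
  · obtain ⟨x, rfl⟩ := List.length_eq_one_iff.1 hlen
    have hx : x ∈ maximalIdeal R := hrs x (by simp)
    have hxr := ((isRegular_cons_iff R x []).1 hreg).1
    exact le_localDepth (by simpa using hx) (isRegular_singleton_of_isSMulRegular hx (hregK x hxr))
  · obtain ⟨x, y, rfl⟩ := List.length_eq_two.1 hlen
    have hx : x ∈ maximalIdeal R := hrs x (by simp)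
    have hy : y ∈ maximalIdeal R := hrs y (by simp)
    obtain ⟨hxr, hyr⟩ := (isRegular_cons_iff R x [y]).1 hreg
    replace hyr := ((isRegular_cons_iff _ y []).1 hyr).1
    -- Working with R × T yields one element regular on both R and T. The socle of R vanishes
    -- because x is regular.
    obtain ⟨r, hr, hreg'⟩ : ∃ r ∈ maximalIdeal R, IsSMulRegular (R × T) r := by
      refine exists_isSMulRegular_of_forall_eq_zero fun t ht => Prod.ext ?_ ?_
      · exact hxr.right_eq_zero_of_smul (congrArg Prod.fst (ht x hx))
      · exact hT _ fun a ha => congrArg Prod.snd (ht a ha)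
    have hrR : IsSMulRegular R r := hreg'.of_injective (LinearMap.inl R R T) LinearMap.inl_injective
    have hrT : IsSMulRegular T r := hreg'.of_injective (LinearMap.inr R R T) LinearMap.inr_injective
    obtain ⟨z, hz, hzr⟩ : ∃ z ∈ maximalIdeal R, IsSMulRegular (QuotSMulTop r R) z := by
      refine exists_isSMulRegular_of_forall_eq_zero fun t ht => ?_
      obtain ⟨t, rfl⟩ := Submodule.Quotient.mk_surjective _ t
      rw [Submodule.Quotient.mk_eq_zero, Submodule.mem_smul_pointwise_iff_exists]
      obtain ⟨c, hc⟩ := exists_eq_mul_of_forall_mul_mem hx hy hxr hyr hrR (u := t) fun a ha => by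
        have := ht a ha
        rw [← Submodule.Quotient.mk_smul, Submodule.Quotient.mk_eq_zero,
          Submodule.mem_smul_pointwise_iff_exists] at this
        obtain ⟨c, -, hc⟩ := this
        exact ⟨c, hc.symm⟩
      exact ⟨c, trivial, hc.symm⟩
    refine le_localDepth (rs := [r, z])
      (by rintro a ha; rcases List.mem_pair.1 ha with rfl | rfl <;> assumption)
      (isRegular_pair_of_isSMulRegular hr hz (hregK r hrR) ?_)
    rw [isSMulRegular_quotSMulTop_iff] at hzr ⊢
    intro u v huv
    -- K/rK embeds in (R/r)^ι because r is regular on T: if f u = r w, then r g(w) = 0, so g(w) = 0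
    -- and w comes from K. Thus z stays regular on K/rK.
    have hw : ∀ i, ∃ w, f u i = r • w := fun i => hzr (f u i) (f v i) (by
      have := congrFun (congrArg f huv) i
      simpa using this)
    choose w hw using hw
    have hgw : g w = 0 := hrT.right_eq_zero_of_smul (by
      rw [← map_smul, show r • w = f u from funext fun i => (hw i).symm, hfg.apply_apply_eq_zero])
    obtain ⟨k, hk⟩ := (hfg w).1 hgw
    refine ⟨k, hf ?_⟩
    rw [map_smul, hk]
    exact funext hw

/-! ### Stable filtrations: socles and linear relations in high degree. -/

section Filtration

variable {A : Type*} [CommRing A] {I : Ideal A} {N : Type*} [AddCommGroup N] [Module A N]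

theorem Submodule.smul_mem_pow_succ_smul {j : ℕ} {a : A} {x : N} {P : Submodule A N} (ha : a ∈ I)
    (hx : x ∈ I ^ j • P) : a • x ∈ I ^ (j + 1) • P := by
  rw [pow_succ', mul_smul]
  exact Submodule.smul_mem_smul ha hx

theorem Submodule.exists_eq_sum_of_mem_span_range_smul {ι : Type*} [Fintype ι] {x : ι → A}
    (hx : Ideal.span (Set.range x) = I) {P : Submodule A N} {y : N} (hy : y ∈ I • P) :
    ∃ z : ι → N, (∀ b, z b ∈ P) ∧ y = ∑ b, x b • z b := by
  subst hx
  induction hy using Submodule.smul_induction_on' with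
  | smul a ha p hp =>
    obtain ⟨c, rfl⟩ := Ideal.mem_span_range_iff_exists_fun.1 ha
    refine ⟨fun b => c b • p, fun b => P.smul_mem _ hp, ?_⟩
    simp [Finset.sum_smul, mul_smul, smul_comm (x _) (c _)]
  | add u _ v _ hu hv =>
    obtain ⟨z, hz, rfl⟩ := hu
    obtain ⟨w, hw, rfl⟩ := hv
    exact ⟨z + w, fun b => P.add_mem (hz b) (hw b), by simp [Finset.sum_add_distrib]⟩

theorem Submodule.mem_smul_top_pi {ι : Type*} [Finite ι] {J : Ideal A} {t : ι → N}
    (ht : ∀ i, t i ∈ J • (⊤ : Submodule A N)) : t ∈ J • (⊤ : Submodule A (ι → N)) := by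
  classical
  cases nonempty_fintype ι
  rw [← Finset.univ_sum_single t]
  exact Submodule.sum_mem _ fun i _ =>
    Submodule.smul_top_le_comap_smul_top J (LinearMap.single A (fun _ => N) i) (ht i)

theorem Submodule.apply_mem_smul_top {ι : Type*} {J : Ideal A} {t : ι → N}
    (ht : t ∈ J • (⊤ : Submodule A (ι → N))) (i : ι) : t i ∈ J • (⊤ : Submodule A N) :=
  Submodule.smul_top_le_comap_smul_top J (LinearMap.proj i) ht

variable [IsNoetherianRing A] [Module.Finite A N]

variable (I N) in
-- The socle of G(N) vanishes in high degree. The elements u of I^j N with I u ⊆ I^(j+2) N form a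
-- filtration W inside the I-adic one, so W is stable; for large j, W_(j+1) = I W_j, and this lies
-- in I^(j+2) N by the very definition of W_j.
theorem Ideal.exists_forall_mem_pow_succ_smul_of_forall_smul_mem :
    ∃ n₀, ∀ j ≥ n₀, ∀ u ∈ I ^ j • (⊤ : Submodule A N),
      (∀ a ∈ I, a • u ∈ I ^ (j + 2) • (⊤ : Submodule A N)) →
        u ∈ I ^ (j + 1) • (⊤ : Submodule A N) := by
  let W : I.Filtration N :=
    { N := fun j =>
        { carrier := {u | u ∈ I ^ j • (⊤ : Submodule A N) ∧
            ∀ a ∈ I, a • u ∈ I ^ (j + 2) • (⊤ : Submodule A N)}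
          add_mem' := fun {u v} hu hv => ⟨add_mem hu.1 hv.1, fun a ha => by
            rw [smul_add]; exact add_mem (hu.2 a ha) (hv.2 a ha)⟩
          zero_mem' := ⟨zero_mem _, fun a _ => by rw [smul_zero]; exact zero_mem _⟩
          smul_mem' := fun c u hu => ⟨Submodule.smul_mem _ c hu.1, fun a ha => by
            rw [smul_comm]; exact Submodule.smul_mem _ c (hu.2 a ha)⟩ }
      mono := fun j u hu => ⟨Submodule.pow_smul_top_le I N (Nat.le_succ j) hu.1, fun a ha =>
        Submodule.pow_smul_top_le I N (Nat.le_succ (j + 2)) (hu.2 a ha)⟩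
      smul_le := fun j => Submodule.smul_le.2 fun a ha u hu =>
        ⟨Submodule.smul_mem_pow_succ_smul ha hu.1, fun b hb =>
          Submodule.smul_mem_pow_succ_smul hb (hu.2 a ha)⟩ }
  obtain ⟨n₀, hn₀⟩ := (I.stableFiltration_stable (⊤ : Submodule A N)).of_le (F' := W)
    fun j u hu => hu.1
  refine ⟨n₀ + 1, fun j hj u hu hu' => ?_⟩
  obtain ⟨j, rfl⟩ : ∃ k, j = k + 1 := ⟨j - 1, by omega⟩
  have h : u ∈ I • W.N j := by rw [hn₀ j (by omega)]; exact ⟨hu, hu'⟩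
  exact (Submodule.smul_le.2 fun a ha v hv => hv.2 a ha : I • W.N j ≤ _) h

/-- The cycles of the map (t_i) ↦ ∑ x_i t_i on G(N) are finitely generated. Concretely, the tuples
in I^q N with ∑ x_i t_i ∈ I^(q+2) N form a stable filtration Z, so for large q a tuple in Z_(q+1) is
a combination ∑ x_b z_b with all z_b in Z_q. -/
theorem Ideal.exists_forall_exists_koszul_lift {ι : Type*} [Fintype ι] (x : ι → A)
    (hx : Ideal.span (Set.range x) = I) (N : Type*) [AddCommGroup N] [Module A N]
    [Module.Finite A N] :
    ∃ n₀, ∀ q ≥ n₀, ∀ t : ι → N, (∀ i, t i ∈ I ^ (q + 1) • (⊤ : Submodule A N)) →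
      ∑ i, x i • t i ∈ I ^ (q + 3) • (⊤ : Submodule A N) →
      ∃ z : ι → ι → N, (∀ b i, z b i ∈ I ^ q • (⊤ : Submodule A N)) ∧
        (∀ b, ∑ i, x i • z b i ∈ I ^ (q + 2) • (⊤ : Submodule A N)) ∧
        ∀ i, t i = ∑ b, x b • z b i := by
  let Z : I.Filtration (ι → N) :=
    { N := fun q =>
        { carrier := {t | (∀ i, t i ∈ I ^ q • (⊤ : Submodule A N)) ∧
            ∑ i, x i • t i ∈ I ^ (q + 2) • (⊤ : Submodule A N)}
          add_mem' := fun {u v} hu hv => ⟨fun i => add_mem (hu.1 i) (hv.1 i), by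
            simp only [Pi.add_apply, smul_add, Finset.sum_add_distrib]
            exact add_mem hu.2 hv.2⟩
          zero_mem' := ⟨fun i => zero_mem _, by simp⟩
          smul_mem' := fun c u hu => ⟨fun i => Submodule.smul_mem _ c (hu.1 i), by
            simp only [Pi.smul_apply, smul_comm (x _) c, ← Finset.smul_sum]
            exact Submodule.smul_mem _ c hu.2⟩ }
      mono := fun q t ht => ⟨fun i => Submodule.pow_smul_top_le I N (Nat.le_succ q) (ht.1 i),
        Submodule.pow_smul_top_le I N (Nat.le_succ (q + 2)) ht.2⟩
      smul_le := fun q => Submodule.smul_le.2 fun a ha t ht =>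
        ⟨fun i => Submodule.smul_mem_pow_succ_smul ha (ht.1 i), by
          simp only [Pi.smul_apply, smul_comm (x _) a, ← Finset.smul_sum]
          exact Submodule.smul_mem_pow_succ_smul ha ht.2⟩ }
  obtain ⟨n₀, hn₀⟩ := (I.stableFiltration_stable (⊤ : Submodule A (ι → N))).of_le (F' := Z)
    fun q t ht => Submodule.mem_smul_top_pi ht.1
  refine ⟨n₀, fun q hq t ht hsum => ?_⟩
  have h : t ∈ I • Z.N q := by rw [hn₀ q hq]; exact ⟨ht, hsum⟩
  obtain ⟨z, hz, rfl⟩ := Submodule.exists_eq_sum_of_mem_span_range_smul hx h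
  exact ⟨z, fun b => (hz b).1, fun b => (hz b).2, fun i => by simp⟩

/-- For large `n`, the relations between generators of `I ^ n N` are generated, up to higher order,
by the linear ones. -/
theorem Ideal.exists_forall_ker_inf_pow_le (I : Ideal A) (N : Type*) [AddCommGroup N] [Module A N]
    [Module.Finite A N] :
    ∃ n₀, ∀ n ≥ n₀, ∀ (F : Type v) [AddCommGroup F] [Module A F] (π : F →ₗ[A] N),
      LinearMap.range π = I ^ n • ⊤ → ∀ j,
        LinearMap.ker π ⊓ I ^ (j + 2) • ⊤ ≤
          I • (LinearMap.ker π ⊓ I ^ (j + 1) • ⊤) ⊔ LinearMap.ker π ⊓ I ^ (j + 3) • ⊤ := by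
  obtain ⟨e, x, hx⟩ := Submodule.fg_iff_exists_fin_generating_family.1 (IsNoetherian.noetherian I)
  replace hx : Ideal.span (Set.range x) = I := hx
  have hxI : ∀ i, x i ∈ I := fun i => hx ▸ Ideal.subset_span ⟨i, rfl⟩
  obtain ⟨n₀, hn₀⟩ := Ideal.exists_forall_exists_koszul_lift x hx N
  refine ⟨n₀, fun n hn F _ _ π hπ j f hf => ?_⟩
  have hmap : ∀ k, (I ^ k • (⊤ : Submodule A F)).map π = I ^ (n + k) • ⊤ := fun k => by
    rw [Submodule.map_smul'', Submodule.map_top, hπ, ← mul_smul, ← pow_add, add_comm]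
  have hmem : ∀ k, ∀ y ∈ I ^ k • (⊤ : Submodule A F), π y ∈ I ^ (n + k) • (⊤ : Submodule A N) :=
    fun k y hy => by rw [← hmap k]; exact Submodule.mem_map_of_mem hy
  have hlift : ∀ k, ∀ y ∈ I ^ (n + k) • (⊤ : Submodule A N),
      ∃ w ∈ I ^ k • (⊤ : Submodule A F), π w = y := fun k y hy => by
    rw [← hmap k] at hy
    exact hy
  obtain ⟨hfker, hfpow⟩ := hf
  obtain ⟨c, hc, rfl⟩ : ∃ c : Fin e → F, (∀ a, c a ∈ I ^ (j + 1) • (⊤ : Submodule A F)) ∧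
      f = ∑ a, x a • c a := by
    refine Submodule.exists_eq_sum_of_mem_span_range_smul hx ?_
    rwa [← mul_smul, ← pow_succ']
  rw [SetLike.mem_coe, LinearMap.mem_ker, map_sum] at hfker
  simp only [map_smul] at hfker
  have hzero : ∑ a, x a • π (c a) ∈ I ^ (n + j + 3) • (⊤ : Submodule A N) := by
    rw [hfker]
    exact Submodule.zero_mem _
  obtain ⟨z, hz, hzsum, hzt⟩ := hn₀ (n + j) (le_add_right hn) (fun a => π (c a))
    (fun a => hmem (j + 1) _ (hc a)) hzero
  choose y hy hyz using fun b a => hlift j (z b a) (hz b a)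
  choose d hd hdz using fun b => hlift (j + 2) _ (hzsum b)
  -- Koszul correction: the antisymmetric terms y_ba - y_ab vanish after multiplying by x_a and
  -- summing. In π, y_ba cancels the expansion of π(c_a), while y_ab contributes ∑ x_b z_ab, which
  -- d_a cancels. The only remainder is ∑ x_a d_a, of order j + 3.
  have hker : ∀ a, c a - ∑ b, x b • (y b a - y a b) - d a ∈
      LinearMap.ker π ⊓ I ^ (j + 1) • (⊤ : Submodule A F) := by
    refine fun a => ⟨?_, sub_mem (sub_mem (hc a) (Submodule.sum_mem _ fun b _ => ?_))
      (Submodule.pow_smul_top_le I F (Nat.le_succ _) (hd a))⟩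
    · rw [SetLike.mem_coe, LinearMap.mem_ker]
      simp only [map_sub, map_sum, map_smul, hyz, hdz, smul_sub, Finset.sum_sub_distrib, hzt a]
      abel
    · exact Submodule.smul_mem_pow_succ_smul (hxI b) (sub_mem (hy _ _) (hy _ _))
  have hsum : ∑ a, x a • c a = ∑ a, x a • (c a - ∑ b, x b • (y b a - y a b) - d a) +
      ∑ a, x a • d a := by
    have h0 : ∑ a, x a • ∑ b, x b • (y b a - y a b) = 0 := by
      simp only [smul_sub, Finset.sum_sub_distrib, Finset.smul_sum]
      rw [Finset.sum_comm, sub_eq_zero]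
      exact Finset.sum_congr rfl fun a _ => Finset.sum_congr rfl fun b _ => smul_comm _ _ _
    simp only [smul_sub _ (_ - _), smul_sub _ (c _), Finset.sum_sub_distrib, h0]
    abel
  have hmemI : ∑ a, x a • (c a - ∑ b, x b • (y b a - y a b) - d a) ∈
      I • (LinearMap.ker π ⊓ I ^ (j + 1) • (⊤ : Submodule A F)) :=
    Submodule.sum_mem _ fun a _ => Submodule.smul_mem_smul (hxI a) (hker a)
  rw [hsum]
  refine Submodule.add_mem_sup hmemI ⟨?_, Submodule.sum_mem _ fun a _ =>
    Submodule.smul_mem_pow_succ_smul (hxI a) (hd a)⟩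
  have hk := (Submodule.smul_le_right.trans inf_le_left : _ ≤ LinearMap.ker π) hmemI
  have := congrArg π hsum
  rw [map_add, LinearMap.mem_ker.1 hk, zero_add] at this
  rw [SetLike.mem_coe, LinearMap.mem_ker, ← this]
  simpa using hfker

variable (I N) in
/-- For large `n`, a minimal presentation of `I ^ n N` has a kernel on which the filtrations induced
by the `I`-adic filtrations of the kernel and of the free module agree up to a shift by one. -/
theorem Ideal.exists_forall_ker_inf_pow_succ_eq :
    ∃ n₀, ∀ n ≥ n₀, ∀ (F : Type v) [AddCommGroup F] [Module A F] [Module.Finite A F]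
      (π : F →ₗ[A] N), LinearMap.range π = I ^ n • ⊤ → LinearMap.ker π ≤ I • ⊤ → ∀ j,
        LinearMap.ker π ⊓ I ^ (j + 1) • ⊤ = I ^ j • LinearMap.ker π := by
  obtain ⟨n₀, hn₀⟩ := Ideal.exists_forall_ker_inf_pow_le.{v} I N
  refine ⟨n₀, fun n hn F _ _ _ π hπ hker => ?_⟩
  have hstep := hn₀ n hn F π hπ
  have hiter : ∀ k j, LinearMap.ker π ⊓ I ^ (j + 2) • ⊤ ≤
      I • (LinearMap.ker π ⊓ I ^ (j + 1) • ⊤) ⊔ LinearMap.ker π ⊓ I ^ (j + k + 3) • ⊤ := by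
    intro k
    induction k with
    | zero => exact hstep
    | succ k ih =>
      intro j
      refine (ih j).trans (sup_le le_sup_left ((hstep (j + k + 1)).trans (sup_le_sup ?_ le_rfl)))
      exact smul_mono_right _ (inf_le_inf_left _
        (Submodule.pow_smul_top_le I F (by omega)))
  -- Artin-Rees for the kernel in F: beyond l, the tail left by `hiter` is itself I times an earlier
  -- intersection, so it can be absorbed.
  obtain ⟨l, hl⟩ := (I.stableFiltration_stable (⊤ : Submodule A F)).inter_left
    (F' := I.trivialFiltration (LinearMap.ker π))
  have heq : ∀ j, LinearMap.ker π ⊓ I ^ (j + 2) • ⊤ =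
      I • (LinearMap.ker π ⊓ I ^ (j + 1) • ⊤) := by
    intro j
    refine le_antisymm ((hiter l j).trans (sup_le le_rfl ?_)) ?_
    · have := hl (j + l + 2) (by omega)
      change I • (LinearMap.ker π ⊓ I ^ (j + l + 2) • ⊤) =
        LinearMap.ker π ⊓ I ^ (j + l + 3) • ⊤ at this
      rw [← this]
      exact smul_mono_right _ (inf_le_inf_left _
        (Submodule.pow_smul_top_le I F (by omega)))
    · refine Submodule.smul_le.2 fun a ha y hy => ⟨Submodule.smul_mem _ _ hy.1, ?_⟩
      exact Submodule.smul_mem_pow_succ_smul ha hy.2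
  intro j
  induction j with
  | zero => simpa using hker
  | succ j ih => rw [heq, ih, pow_succ', mul_smul]

end Filtration

/-! ### Minimal generators and localization at maximal ideals. -/

open IsLocalRing TensorProduct in
/-- A finite module over a local ring has a finite generating family all of whose relations have
coefficients in the maximal ideal. -/
theorem IsLocalRing.exists_minimal_generating_family (A : Type*) [CommRing A] [IsLocalRing A]
    (N : Type*) [AddCommGroup N] [Module A N] [Module.Finite A N] :
    ∃ (s : ℕ) (g : Fin s → N), Submodule.span A (Set.range g) = ⊤ ∧
      ∀ c : Fin s → A, ∑ i, c i • g i = 0 → ∀ i, c i ∈ maximalIdeal A := by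
  let b := Module.finBasis (ResidueField A) (ResidueField A ⊗[A] N)
  choose g hg using fun i => TensorProduct.mk_surjective A N (ResidueField A)
    IsLocalRing.residue_surjective (b i)
  refine ⟨_, g, IsLocalRing.span_eq_top_of_tmul_eq_basis g b hg, fun c hc i => ?_⟩
  have h : ∑ i, residue A (c i) • b i = 0 := by
    have := congrArg (TensorProduct.mk A (ResidueField A) N 1) hc
    rw [map_sum, map_zero] at this
    rw [← this]
    refine Finset.sum_congr rfl fun i _ => ?_
    rw [map_smul, hg, ← ResidueField.algebraMap_eq, algebraMap_smul]
  have := Fintype.linearIndependent_iff.1 b.linearIndependent _ h i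
  rwa [residue_eq_zero_iff] at this

open RingTheory.Sequence in
theorem localDepth_le_of_linearEquiv {R : Type u} [CommRing R] [IsLocalRing R] {L L' : Type*}
    [AddCommGroup L] [Module R L] [AddCommGroup L'] [Module R L'] (e : L ≃ₗ[R] L') :
    localDepth R L ≤ localDepth R L' :=
  iSup₂_le fun rs hrs => iSup_le fun hreg => le_localDepth hrs ((e.isRegular_congr rs).1 hreg)

theorem IsLocalCohenMacaulay.of_linearEquiv {R : Type u} [CommRing R] [IsLocalRing R]
    {L L' : Type*} [AddCommGroup L] [Module R L] [AddCommGroup L'] [Module R L'] (e : L ≃ₗ[R] L')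
    (h : IsLocalCohenMacaulay R L) : IsLocalCohenMacaulay R L' := by
  intro hL'
  have := e.toEquiv.nontrivial
  rw [← Module.supportDim_eq_of_equiv e, ← h this,
    le_antisymm (localDepth_le_of_linearEquiv e) (localDepth_le_of_linearEquiv e.symm)]

theorem LocalizedModule.mk_eq_zero_iff {G : Type*} [CommRing G] {S : Submonoid G} {T : Type*}
    [AddCommGroup T] [Module G T] {t : T} {s : S} :
    LocalizedModule.mk t s = 0 ↔ ∃ c : S, c • t = 0 := by
  rw [← LocalizedModule.zero_mk 1, LocalizedModule.mk_eq]
  simp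

/-- If no nonzero element of `T` is annihilated by the prime ideal `p`, then the same holds for
the localization of `T` at `p`. -/
theorem LocalizedModule.eq_zero_of_forall_maximalIdeal_smul_eq_zero {G : Type*} [CommRing G]
    [IsNoetherianRing G] (p : Ideal G) [p.IsPrime] {T : Type*} [AddCommGroup T] [Module G T]
    (hT : ∀ t : T, (∀ a ∈ p, a • t = 0) → t = 0) (t : LocalizedModule p.primeCompl T)
    (ht : ∀ a ∈ IsLocalRing.maximalIdeal (Localization.AtPrime p), a • t = 0) : t = 0 := by
  induction t using LocalizedModule.induction_on with
  | h t s =>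
    have hs : ∀ a ∈ p, ∃ c : p.primeCompl, c • a • t = 0 := fun a ha => by
      have h := ht (algebraMap G _ a) ((IsLocalization.AtPrime.to_map_mem_maximal_iff _ p a).2 ha)
      rw [algebraMap_smul, LocalizedModule.smul'_mk, LocalizedModule.mk_eq_zero_iff] at h
      exact h
    obtain ⟨S, hS⟩ := IsNoetherian.noetherian p
    choose! c hc using hs
    -- Multiplying t by the product of the multipliers of finitely many generators of p makes all of
    -- p kill it before localizing.
    have hprod : ∀ a ∈ p, a • (∏ b ∈ S, c b) • t = 0 := by
      intro a ha
      rw [← hS] at ha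
      induction ha using Submodule.span_induction with
      | mem b hb =>
        obtain ⟨d, hd⟩ := Finset.dvd_prod_of_mem c hb
        rw [hd, mul_comm, mul_smul, smul_comm, smul_comm b,
          hc b (hS ▸ Submodule.subset_span hb), smul_zero]
      | zero => simp
      | add x y _ _ hx hy => rw [add_smul, hx, hy, add_zero]
      | smul r x _ hx => rw [smul_assoc, hx, smul_zero]
    exact (LocalizedModule.mk_eq_zero_iff).2 ⟨_, hT _ hprod⟩

/-- Over a Cohen-Macaulay ring of dimension at most two, the first syzygy of a module to
which no maximal ideal is associated is Cohen-Macaulay. -/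
theorem IsCohenMacaulay.of_syzygy {G : Type u} [CommRing G] [IsNoetherianRing G]
    (hG : IsCohenMacaulay G G) (hdim : ringKrullDim G ≤ 2) {ι : Type*} [Finite ι] {K : Type v}
    [AddCommGroup K] [Module G K] {T : Type*} [AddCommGroup T] [Module G T]
    (f : K →ₗ[G] (ι → G)) (g : (ι → G) →ₗ[G] T)
    (hf : Function.Injective f) (hfg : Function.Exact f g) (hg : Function.Surjective g)
    (hT : ∀ p : Ideal G, p.IsMaximal → ∀ t : T, (∀ a ∈ p, a • t = 0) → t = 0) :
    IsCohenMacaulay G K := by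
  intro p hp hK
  have hR : IsLocalCohenMacaulay (Localization.AtPrime p) (Localization.AtPrime p) :=
    (hG p).of_linearEquiv ((IsLocalizedModule.linearEquiv p.primeCompl
      (LocalizedModule.mkLinearMap p.primeCompl G)
      (Algebra.linearMap G (Localization.AtPrime p))).extendScalarsOfIsLocalization p.primeCompl
        (Localization.AtPrime p))
  have hd : ringKrullDim (Localization.AtPrime p) ≤ 2 := by
    rw [IsLocalization.AtPrime.ringKrullDim_eq_height p]
    exact (Ideal.height_le_ringKrullDim_of_ne_top hp.ne_top).trans hdim
  let φ : (ι → G) →ₗ[G] (ι → Localization.AtPrime p) :=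
    .pi fun i => Algebra.linearMap G (Localization.AtPrime p) ∘ₗ .proj i
  let κ := LocalizedModule.mkLinearMap p.primeCompl K
  let τ := LocalizedModule.mkLinearMap p.primeCompl T
  obtain ⟨h1, h2⟩ := localDepth_and_supportDim_of_syzygy hR hd
    (IsLocalizedModule.mapExtendScalars p.primeCompl κ φ (Localization.AtPrime p) f)
    (IsLocalizedModule.mapExtendScalars p.primeCompl φ τ (Localization.AtPrime p) g)
    (IsLocalizedModule.map_injective p.primeCompl κ φ f hf)
    (IsLocalizedModule.map_exact p.primeCompl κ φ τ f g hfg)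
    (IsLocalizedModule.map_surjective p.primeCompl φ τ g hg)
    (LocalizedModule.eq_zero_of_forall_maximalIdeal_smul_eq_zero p (hT p hp))
  rw [h1, h2]

/-! ### The associated graded sequence of a syzygy. -/

noncomputable section

namespace AssocGraded

variable {A : Type u} [CommRing A] (I : Ideal A) (M : Type v) [AddCommGroup M] [Module A M]

/-- The inclusion of the component of degree `n` into the associated graded module. -/
def of (n : ℕ) : Piece I M n →+ AssocGradedModule I M := DirectSum.of (Piece I M) n

/-- The inclusion of the component of degree `n` into the associated graded ring. -/
def ofRing (n : ℕ) : Piece I A n →+ AssocGradedRing I := DirectSum.of (Piece I A) n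

/-- The projection of the associated graded module to the component of degree `n`. -/
def comp (n : ℕ) : AssocGradedModule I M →+ Piece I M n :=
  DFinsupp.evalAddMonoidHom (β := Piece I M) n

/-- The projection of the associated graded ring to the component of degree `n`. -/
def compRing (n : ℕ) : AssocGradedRing I →+ Piece I A n :=
  DFinsupp.evalAddMonoidHom (β := Piece I A) n

variable {I M}

theorem comp_of_same (n : ℕ) (y : Piece I M n) : comp I M n (of I M n y) = y :=
  DirectSum.of_eq_same n y

theorem comp_of_ne {i n : ℕ} (h : i ≠ n) (y : Piece I M i) : comp I M n (of I M i y) = 0 :=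
  DirectSum.of_eq_of_ne i n y h.symm

theorem compRing_ofRing_same (n : ℕ) (y : Piece I A n) : compRing I n (ofRing I n y) = y :=
  DirectSum.of_eq_same n y

theorem compRing_ofRing_ne {i n : ℕ} (h : i ≠ n) (y : Piece I A i) :
    compRing I n (ofRing I i y) = 0 :=
  DirectSum.of_eq_of_ne i n y h.symm

theorem ext_comp {t t' : AssocGradedModule I M} (h : ∀ n, comp I M n t = comp I M n t') : t = t' :=
  DFinsupp.ext h

theorem ext_compRing {t t' : AssocGradedRing I} (h : ∀ n, compRing I n t = compRing I n t') :
    t = t' :=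
  DFinsupp.ext h

theorem ofRing_mul_ofRing {i j : ℕ} (a : Piece I A i) (b : Piece I A j) :
    ofRing I i a * ofRing I j b = ofRing I (i + j) (pieceSMul I A i j a b) :=
  DirectSum.of_mul_of a b

theorem ofRing_smul_of {i j : ℕ} (a : Piece I A i) (x : Piece I M j) :
    ofRing I i a • of I M j x = of I M (i + j) (pieceSMul I M i j a x) :=
  DirectSum.Gmodule.of_smul_of (Piece I A) (Piece I M) a x

theorem induction_module {motive : AssocGradedModule I M → Prop} (zero : motive 0)
    (of : ∀ n x hx, motive (of I M n (mk I n x hx)))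
    (add : ∀ t t', motive t → motive t' → motive (t + t')) (t : AssocGradedModule I M) :
    motive t :=
  DirectSum.induction_on (motive := motive) t zero (fun n y => by
    obtain ⟨x, hx, rfl⟩ := exists_mk y
    exact of n x hx) add

theorem induction_ring {motive : AssocGradedRing I → Prop} (zero : motive 0)
    (of : ∀ n x hx, motive (ofRing I n (mk I n x hx)))
    (add : ∀ t t', motive t → motive t' → motive (t + t')) (t : AssocGradedRing I) :
    motive t :=
  DirectSum.induction_on (motive := motive) t zero (fun n y => by
    obtain ⟨x, hx, rfl⟩ := exists_mk y
    exact of n x hx) add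

theorem mem_powSMul_zero (x : M) : x ∈ powSMul I M 0 := by
  rw [powSMul, pow_zero, Ideal.one_eq_top, Submodule.top_smul]
  trivial

theorem mk_eq_zero_iff {n : ℕ} {x : M} {hx : x ∈ powSMul I M n} :
    mk I n x hx = 0 ↔ x ∈ powSMul I M (n + 1) :=
  Submodule.Quotient.mk_eq_zero _

theorem mk_add {n : ℕ} {x y : M} (hx : x ∈ powSMul I M n) (hy : y ∈ powSMul I M n) :
    mk I n x hx + mk I n y hy = mk I n (x + y) (add_mem hx hy) := rfl

theorem mk_eq_mk_iff {n : ℕ} {x y : M} {hx : x ∈ powSMul I M n} {hy : y ∈ powSMul I M n} :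
    mk I n x hx = mk I n y hy ↔ x - y ∈ powSMul I M (n + 1) :=
  Submodule.Quotient.eq _

theorem mk_sum {n : ℕ} {κ : Type*} (s : Finset κ) (x : κ → M)
    (hx : ∀ k, x k ∈ powSMul I M n) :
    ∑ k ∈ s, mk I n (x k) (hx k) = mk I n (∑ k ∈ s, x k) (sum_mem fun k _ => hx k) := by
  classical
  induction s using Finset.induction_on with
  | empty => exact (Submodule.Quotient.mk_zero _).symm
  | insert k s hk ih =>
    rw [Finset.sum_insert hk, ih, mk_add]
    congr 1
    exact (Finset.sum_insert hk).symm

variable (I) in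
theorem exists_forall_eq_sum_ofRing (r : AssocGradedRing I) :
    ∃ n₀, ∀ n ≥ n₀, r = ∑ l ∈ Finset.range n, ofRing I l (compRing I l r) := by
  induction r using induction_ring with
  | zero => exact ⟨0, fun n _ => by simp⟩
  | of i x hx =>
    refine ⟨i + 1, fun n hn => ?_⟩
    rw [Finset.sum_eq_single i, compRing_ofRing_same]
    · intro l _ hl
      rw [compRing_ofRing_ne hl.symm, map_zero]
    · intro h
      simp at h
      omega
  | add r r' hr hr' =>
    obtain ⟨n, hn⟩ := hr
    obtain ⟨n', hn'⟩ := hr'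
    refine ⟨max n n', fun k hk => ?_⟩
    simp only [map_add, Finset.sum_add_distrib]
    rw [← hn k (le_of_max_le_left hk), ← hn' k (le_of_max_le_right hk)]

theorem comp_smul_of_zero (l : ℕ) (r : AssocGradedRing I) (y : Piece I M 0) :
    comp I M l (r • of I M 0 y) = pieceSMul I M l 0 (compRing I l r) y := by
  induction r using induction_ring with
  | zero => simp
  | of i x hx =>
    rw [ofRing_smul_of]
    by_cases h : i = l
    · subst h
      rw [compRing_ofRing_same]
      exact comp_of_same i _
    · rw [comp_of_ne (by simpa using h), compRing_ofRing_ne h]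
      simp
  | add r r' hr hr' => rw [add_smul, map_add, hr, hr', map_add, map_add]; rfl

/-- The map `I ^ n M / I ^ (n + 1) M → I ^ (n + 1) / I ^ (n + 2)` induced by a linear map
`M → A` that raises the order by one. -/
def pieceShift (f : M →ₗ[A] A) (hf : ∀ n, ∀ x ∈ powSMul I M n, f x ∈ powSMul I A (n + 1))
    (n : ℕ) : Piece I M n →ₗ[A] Piece I A (n + 1) :=
  Submodule.mapQ _ _ (f.restrict (hf n)) fun _ hx => hf (n + 1) _ hx

theorem pieceShift_mk (f : M →ₗ[A] A)
    (hf : ∀ n, ∀ x ∈ powSMul I M n, f x ∈ powSMul I A (n + 1)) {n : ℕ} {x : M}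
    (hx : x ∈ powSMul I M n) :
    pieceShift f hf n (mk I n x hx) = mk I (n + 1) (f x) (hf n x hx) := rfl

/-- The map of associated graded modules of degree one induced by a linear map `M → A` that raises
the order by one, as an additive map. -/
def shiftAddHom (f : M →ₗ[A] A) (hf : ∀ n, ∀ x ∈ powSMul I M n, f x ∈ powSMul I A (n + 1)) :
    AssocGradedModule I M →+ AssocGradedRing I :=
  DirectSum.toAddMonoid fun n => (ofRing I (n + 1)).comp (pieceShift f hf n).toAddMonoidHom

theorem shiftAddHom_of (f : M →ₗ[A] A)
    (hf : ∀ n, ∀ x ∈ powSMul I M n, f x ∈ powSMul I A (n + 1)) {n : ℕ} (y : Piece I M n) :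
    shiftAddHom f hf (of I M n y) = ofRing I (n + 1) (pieceShift f hf n y) :=
  DirectSum.toAddMonoid_of _ _ _

/-- The linear map of associated graded modules of degree one induced by a linear map `M → A` that
raises the order by one. -/
def shiftMap (f : M →ₗ[A] A) (hf : ∀ n, ∀ x ∈ powSMul I M n, f x ∈ powSMul I A (n + 1)) :
    AssocGradedModule I M →ₗ[AssocGradedRing I] AssocGradedRing I where
  toFun := shiftAddHom f hf
  map_add' := map_add _
  map_smul' r t := by
    rw [RingHom.id_apply, smul_eq_mul]
    induction r using induction_ring with
    | zero => simp
    | add r r' hr hr' => rw [add_smul, map_add, hr, hr', add_mul]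
    | of i a ha =>
      induction t using induction_module with
      | zero => simp
      | add t t' ht ht' => rw [smul_add, map_add, ht, ht', map_add, mul_add]
      | of j x hx =>
        rw [ofRing_smul_of, shiftAddHom_of, shiftAddHom_of, ofRing_mul_ofRing, pieceSMul_mk,
          pieceShift_mk, pieceShift_mk, pieceSMul_mk]
        congr 2
        exact map_smul f a x

theorem shiftMap_of (f : M →ₗ[A] A)
    (hf : ∀ n, ∀ x ∈ powSMul I M n, f x ∈ powSMul I A (n + 1)) {n : ℕ} (y : Piece I M n) :
    shiftMap f hf (of I M n y) = ofRing I (n + 1) (pieceShift f hf n y) :=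
  shiftAddHom_of f hf y

theorem compRing_shiftMap (f : M →ₗ[A] A)
    (hf : ∀ n, ∀ x ∈ powSMul I M n, f x ∈ powSMul I A (n + 1)) (n : ℕ)
    (t : AssocGradedModule I M) :
    compRing I (n + 1) (shiftMap f hf t) = pieceShift f hf n (comp I M n t) := by
  induction t using induction_module with
  | zero => simp
  | add t t' ht ht' => rw [map_add, map_add, ht, ht', map_add, map_add]
  | of j x hx =>
    rw [shiftMap_of]
    by_cases h : j = n
    · subst h
      rw [compRing_ofRing_same, comp_of_same]
    · rw [compRing_ofRing_ne (by omega), comp_of_ne h, map_zero]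

section Syzygy

variable {N : Type*} [AddCommGroup N] [Module A N] {ι : Type*} [Fintype ι] {g : ι → N}

theorem coe_apply_mem_powSMul
    (H : ∀ j, LinearMap.ker (Fintype.linearCombination A g) ⊓ I ^ (j + 1) • ⊤ =
      I ^ j • LinearMap.ker (Fintype.linearCombination A g)) (i : ι) (n : ℕ)
    (x : LinearMap.ker (Fintype.linearCombination A g)) (hx : x ∈ powSMul I _ n) :
    (x : ι → A) i ∈ powSMul I A (n + 1) := by
  rw [powSMul, Submodule.mem_smul_top_iff, ← H] at hx
  exact Submodule.apply_mem_smul_top hx.2 i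

theorem coord_mem_of_mem_powSMul
    (H : ∀ j, LinearMap.ker (Fintype.linearCombination A g) ⊓ I ^ (j + 1) • ⊤ =
      I ^ j • LinearMap.ker (Fintype.linearCombination A g)) (i : ι) (n : ℕ)
    (x : LinearMap.ker (Fintype.linearCombination A g)) (hx : x ∈ powSMul I _ n) :
    (LinearMap.proj i ∘ₗ (LinearMap.ker (Fintype.linearCombination A g)).subtype) x ∈
      powSMul I A (n + 1) :=
  coe_apply_mem_powSMul H i n x hx

variable (g) in
/-- The inclusion of the associated graded module of a syzygy module into a free module. -/
def syzygyMap
    (H : ∀ j, LinearMap.ker (Fintype.linearCombination A g) ⊓ I ^ (j + 1) • ⊤ =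
      I ^ j • LinearMap.ker (Fintype.linearCombination A g)) :
    AssocGradedModule I (LinearMap.ker (Fintype.linearCombination A g)) →ₗ[AssocGradedRing I]
      (ι → AssocGradedRing I) :=
  LinearMap.pi fun i => shiftMap _ (coord_mem_of_mem_powSMul H i)

theorem syzygyMap_of_mk
    (H : ∀ j, LinearMap.ker (Fintype.linearCombination A g) ⊓ I ^ (j + 1) • ⊤ =
      I ^ j • LinearMap.ker (Fintype.linearCombination A g)) {n : ℕ}
    (x : LinearMap.ker (Fintype.linearCombination A g)) (hx : x ∈ powSMul I _ n) (i : ι) :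
    syzygyMap g H (of I _ n (mk I n x hx)) i =
      ofRing I (n + 1) (mk I (n + 1) ((x : ι → A) i) (coe_apply_mem_powSMul H i n x hx)) :=
  shiftMap_of _ (coord_mem_of_mem_powSMul H i) _

variable (I g) in
/-- The map from a free module to the associated graded module given by a family of elements
of degree zero. -/
def generatorMap : (ι → AssocGradedRing I) →ₗ[AssocGradedRing I] AssocGradedModule I N :=
  Fintype.linearCombination (AssocGradedRing I) fun i => of I N 0 (mk I 0 (g i) (mem_powSMul_zero _))

/-- `H` says that order n + 1 in the free module means order n in the kernel, so a nonzero initial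
form of the kernel stays nonzero after the shift by one. -/
theorem syzygyMap_injective
    (H : ∀ j, LinearMap.ker (Fintype.linearCombination A g) ⊓ I ^ (j + 1) • ⊤ =
      I ^ j • LinearMap.ker (Fintype.linearCombination A g)) :
    Function.Injective (syzygyMap g H) := by
  rw [injective_iff_map_eq_zero]
  intro t ht
  refine ext_comp fun n => ?_
  obtain ⟨w, hw, hwt⟩ := exists_mk (comp I _ n t)
  rw [hwt, map_zero, mk_eq_zero_iff, powSMul, Submodule.mem_smul_top_iff, ← H]
  refine ⟨w.2, Submodule.mem_smul_top_pi fun i => ?_⟩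
  have h : compRing I (n + 1) (syzygyMap g H t i) = 0 := by rw [ht]; exact map_zero _
  erw [compRing_shiftMap, hwt, pieceShift_mk, mk_eq_zero_iff] at h
  exact h

theorem generatorMap_surjective (hg : Submodule.span A (Set.range g) = ⊤) :
    Function.Surjective (generatorMap I g) := by
  intro t
  rw [← LinearMap.mem_range]
  induction t using induction_module with
  | zero => exact zero_mem _
  | add t t' ht ht' => exact add_mem ht ht'
  | of n x hx =>
    have hmap : (I ^ n • (⊤ : Submodule A (ι → A))).map (Fintype.linearCombination A g) =
        I ^ n • ⊤ := by
      rw [Submodule.map_smul'', Submodule.map_top, Fintype.range_linearCombination, hg]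
    have hx' := hx
    rw [powSMul, ← hmap] at hx'
    obtain ⟨a, ha, rfl⟩ := hx'
    refine ⟨fun i => ofRing I n (mk I n (a i) (Submodule.apply_mem_smul_top ha i)), ?_⟩
    rw [generatorMap, Fintype.linearCombination_apply]
    simp only [ofRing_smul_of, pieceSMul_mk]
    rw [← map_sum]
    exact congrArg _ (mk_sum _ _ _)

/-- A homogeneous relation of degree l is a relation modulo I^(l+1) N. Subtracting a tuple b of
order l + 1 with the same image makes it an honest relation without changing its initial form, and
`H` gives its order in the kernel. -/
theorem exact_syzygyMap_generatorMap (hg : Submodule.span A (Set.range g) = ⊤)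
    (H : ∀ j, LinearMap.ker (Fintype.linearCombination A g) ⊓ I ^ (j + 1) • ⊤ =
      I ^ j • LinearMap.ker (Fintype.linearCombination A g)) :
    Function.Exact (syzygyMap g H) (generatorMap I g) := by
  have hmap : ∀ n, (I ^ n • (⊤ : Submodule A (ι → A))).map (Fintype.linearCombination A g) =
      I ^ n • ⊤ := fun n => by
    rw [Submodule.map_smul'', Submodule.map_top, Fintype.range_linearCombination, hg]
  have hker : LinearMap.ker (Fintype.linearCombination A g) ≤ I • ⊤ := by
    have := H 0
    simp only [zero_add, pow_one, pow_zero, Ideal.one_eq_top, Submodule.top_smul] at this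
    exact inf_eq_left.1 this
  rw [LinearMap.exact_iff]
  refine le_antisymm (fun v hv => ?_) ?_
  · rw [LinearMap.mem_ker] at hv
    choose n₀ hn₀ using fun i => exists_forall_eq_sum_ofRing I (v i)
    have hv' : v = ∑ l ∈ Finset.range (Finset.univ.sup n₀),
        fun i => ofRing I l (compRing I l (v i)) := by
      funext i
      rw [Finset.sum_apply]
      exact hn₀ i _ (Finset.le_sup (Finset.mem_univ i))
    rw [hv']
    refine sum_mem fun l _ => ?_
    choose a ha hav using fun i => exists_mk (compRing I l (v i))
    have hsum : ∑ i, a i • g i ∈ I ^ (l + 1) • (⊤ : Submodule A N) := by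
      have h := congrArg (comp I N l) hv
      rw [generatorMap, Fintype.linearCombination_apply, map_sum, map_zero] at h
      simp only [comp_smul_of_zero, hav, pieceSMul_mk] at h
      rw [mk_sum Finset.univ (fun i => a i • g i), mk_eq_zero_iff] at h
      exact h
    rw [← hmap] at hsum
    obtain ⟨b, hb, hbsum⟩ := hsum
    have hab : (fun i => a i) - b ∈ LinearMap.ker (Fintype.linearCombination A g) := by
      rw [LinearMap.mem_ker, map_sub, hbsum, Fintype.linearCombination_apply, sub_self]
    cases l with
    -- The shift leaves no source degree for l = 0: minimality (`hker`) puts every a_i in I, so this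
    -- component is already zero.
    | zero =>
      refine ⟨0, ?_⟩
      rw [map_zero]
      funext i
      have h1 := Submodule.apply_mem_smul_top (hker hab) i
      have h2 := Submodule.apply_mem_smul_top hb i
      have h3 : a i ∈ powSMul I A 1 := by
        rw [zero_add, pow_one] at h2
        rw [powSMul, pow_one]
        simpa using add_mem h1 h2
      simp only [Pi.zero_apply, hav]
      rw [mk_eq_zero_iff.2 h3, map_zero]
    | succ l =>
      have hmem : (fun i => a i) - b ∈ I ^ (l + 1) • (⊤ : Submodule A (ι → A)) :=
        sub_mem (Submodule.mem_smul_top_pi ha) (Submodule.pow_smul_top_le I _ (Nat.le_succ _) hb)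
      have hw : (⟨_, hab⟩ : LinearMap.ker (Fintype.linearCombination A g)) ∈ powSMul I _ l := by
        rw [powSMul, Submodule.mem_smul_top_iff, ← H]
        exact ⟨hab, hmem⟩
      refine ⟨of I _ l (mk I l _ hw), ?_⟩
      funext i
      rw [syzygyMap_of_mk, hav]
      congr 1
      rw [mk_eq_mk_iff]
      have := Submodule.apply_mem_smul_top (neg_mem hb) i
      simpa using this
  · rintro _ ⟨t, rfl⟩
    rw [LinearMap.mem_ker]
    induction t using induction_module with
    | zero => simp
    | add t t' ht ht' => rw [map_add, map_add, ht, ht', add_zero]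
    | of n x hx =>
      rw [generatorMap, Fintype.linearCombination_apply]
      simp only [syzygyMap_of_mk, ofRing_smul_of, pieceSMul_mk]
      rw [← map_sum]
      have h0 : ∑ i, (x : ι → A) i • g i = 0 := x.2
      rw [mk_sum Finset.univ (fun i => (x : ι → A) i • g i), mk_eq_zero_iff.2, map_zero]
      rw [h0]
      exact zero_mem _

end Syzygy

end AssocGraded

end

/-! ### Socle of the graded module; Noetherianity of the graded ring. -/

noncomputable section

namespace AssocGraded

section Socle

variable {A : Type u} [CommRing A] {I : Ideal A} {M : Type v} [AddCommGroup M] [Module A M]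

theorem comp_ofRing_smul_add (i k : ℕ) (a : Piece I A i) (t : AssocGradedModule I M) :
    comp I M (i + k) (ofRing I i a • t) = pieceSMul I M i k a (comp I M k t) := by
  induction t using induction_module with
  | zero => simp
  | add t t' ht ht' => rw [smul_add, map_add, ht, ht', map_add, map_add]
  | of j x hx =>
    rw [ofRing_smul_of]
    by_cases h : j = k
    · subst h
      rw [comp_of_same, comp_of_same]
    · rw [comp_of_ne (by omega), comp_of_ne h, map_zero]

theorem comp_ofRing_smul_of_lt {i l : ℕ} (hl : l < i) (a : Piece I A i)
    (t : AssocGradedModule I M) : comp I M l (ofRing I i a • t) = 0 := by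
  induction t using induction_module with
  | zero => simp
  | add t t' ht ht' => rw [smul_add, map_add, ht, ht', add_zero]
  | of j x hx => rw [ofRing_smul_of, comp_of_ne (by omega)]

theorem comp_ofRing_smul_eq_zero_of_forall_lt {i n : ℕ} (a : Piece I A i)
    {t : AssocGradedModule I M} (ht : ∀ l < n, comp I M l t = 0) (l : ℕ) (hl : l < i + n) :
    comp I M l (ofRing I i a • t) = 0 := by
  by_cases h : l < i
  · exact comp_ofRing_smul_of_lt h a t
  · obtain ⟨k, rfl⟩ := Nat.exists_eq_add_of_le (not_lt.1 h)
    rw [comp_ofRing_smul_add, ht k (by omega), map_zero]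

theorem comp_smul_eq_zero_of_forall_lt {n : ℕ} (r : AssocGradedRing I)
    {t : AssocGradedModule I M} (ht : ∀ l < n, comp I M l t = 0) (l : ℕ) (hl : l < n) :
    comp I M l (r • t) = 0 := by
  induction r using induction_ring with
  | zero => simp
  | add r r' hr hr' => rw [add_smul, map_add, hr, hr', add_zero]
  | of i x hx => exact comp_ofRing_smul_eq_zero_of_forall_lt _ ht l (by omega)

/-- If no nonzero homogeneous element of the associated graded module is annihilated by the
irrelevant ideal, then no nonzero element is annihilated by a maximal ideal. -/
theorem eq_zero_of_forall_mem_isMaximal_smul_eq_zero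
    (hM : ∀ j, ∀ u ∈ powSMul I M j, (∀ a ∈ I, a • u ∈ powSMul I M (j + 2)) →
      u ∈ powSMul I M (j + 1))
    (p : Ideal (AssocGradedRing I)) (hp : p.IsMaximal) (t : AssocGradedModule I M)
    (ht : ∀ r ∈ p, r • t = 0) : t = 0 := by
  -- The ideal p need not be homogeneous. If a degree-one a is outside p, it is invertible modulo p,
  -- so t = a(yt), and iterating pushes the order of t to infinity. Otherwise all degree-one
  -- elements kill t, hence each component of t, and `hM` applies.
  by_cases h : ∃ a : Piece I A 1, ofRing I 1 a ∉ p
  · obtain ⟨a, ha⟩ := h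
    obtain ⟨y, i, hi, hyi⟩ := hp.exists_inv ha
    have hts : t = ofRing I 1 a • y • t := by
      conv_lhs => rw [← one_smul (AssocGradedRing I) t, ← hyi, add_smul, ht i hi, add_zero,
        mul_comm, mul_smul]
    have hord : ∀ n, ∀ l < n, comp I M l t = 0 := by
      intro n
      induction n with
      | zero => intro l hl; omega
      | succ n ih =>
        intro l hl
        rw [hts]
        exact comp_ofRing_smul_eq_zero_of_forall_lt a (comp_smul_eq_zero_of_forall_lt y ih) l
          (by omega)
    exact ext_comp fun n => by rw [hord (n + 1) n (by omega), map_zero]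
  · push Not at h
    refine ext_comp fun n => ?_
    obtain ⟨w, hw, hwt⟩ := exists_mk (comp I M n t)
    rw [hwt, map_zero, mk_eq_zero_iff]
    refine hM n w hw fun a ha => ?_
    have ha' : a ∈ powSMul I A 1 := by simpa [powSMul] using ha
    have := comp_ofRing_smul_add 1 n (mk I 1 a ha') t
    rw [ht _ (h _), map_zero, hwt, pieceSMul_mk, eq_comm, mk_eq_zero_iff,
      show 1 + n + 1 = n + 2 by omega] at this
    exact this

end Socle

section Ring

variable {A : Type u} [CommRing A] (I : Ideal A)

theorem ofRing_mk_congr {I : Ideal A} {i j : ℕ} (h : i = j) {x y : A} (hxy : x = y)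
    (hx : x ∈ powSMul I A i) (hy : y ∈ powSMul I A j) :
    ofRing I i (mk I i x hx) = ofRing I j (mk I j y hy) := by
  subst h; subst hxy; rfl

/-- The structure map of the associated graded ring. -/
def baseHom : A →+* AssocGradedRing I where
  toFun a := ofRing I 0 (mk I 0 a (mem_powSMul_zero a))
  map_one' := rfl
  map_mul' a b := by
    rw [ofRing_mul_ofRing, pieceSMul_mk]
    rfl
  map_zero' := by
    rw [mk_eq_zero_iff.2 (zero_mem _), map_zero]
  map_add' a b := by
    rw [← map_add, mk_add]

theorem baseHom_apply (a : A) : baseHom I a = ofRing I 0 (mk I 0 a (mem_powSMul_zero a)) := rfl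

theorem baseHom_eq_zero {a : A} (ha : a ∈ I) : baseHom I a = 0 := by
  rw [baseHom_apply, mk_eq_zero_iff.2, map_zero]
  simpa [powSMul] using ha

theorem compRing_baseHom_mul (a : A) (l : ℕ) (r : AssocGradedRing I) :
    compRing I l (baseHom I a * r) = a • compRing I l r := by
  induction r using induction_ring with
  | zero => simp
  | add r r' hr hr' => rw [mul_add, map_add, hr, hr', map_add, smul_add]
  | of j x hx =>
    rw [baseHom_apply, ofRing_mul_ofRing, pieceSMul_mk,
      ofRing_mk_congr (zero_add j) rfl _ (Submodule.smul_mem _ a hx)]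
    by_cases h : j = l
    · subst h
      rw [compRing_ofRing_same, compRing_ofRing_same]
      rfl
    · rw [compRing_ofRing_ne h, compRing_ofRing_ne h, smul_zero]

theorem compRing_mul_eq_zero {d e : ℕ} {r r' : AssocGradedRing I}
    (hr : ∀ l > d, compRing I l r = 0) (hr' : ∀ l > e, compRing I l r' = 0) :
    ∀ l > d + e, compRing I l (r * r') = 0 := by
  intro l hl
  obtain ⟨n, hn⟩ := exists_forall_eq_sum_ofRing I r
  obtain ⟨n', hn'⟩ := exists_forall_eq_sum_ofRing I r'
  rw [hn n le_rfl, hn' n' le_rfl, Finset.sum_mul_sum, map_sum]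
  refine Finset.sum_eq_zero fun i _ => ?_
  rw [map_sum]
  refine Finset.sum_eq_zero fun j _ => ?_
  rw [ofRing_mul_ofRing]
  by_cases hi : d < i
  · rw [hr i hi]; simp
  by_cases hj : e < j
  · rw [hr' j hj]; simp
  · exact compRing_ofRing_ne (by omega) _

theorem compRing_one_eq_zero : ∀ l > 0, compRing I l 1 = 0 := fun l hl => by
  rw [← map_one (baseHom I), baseHom_apply, compRing_ofRing_ne hl.ne]

theorem compRing_pow_eq_zero {d : ℕ} {r : AssocGradedRing I} (hr : ∀ l > d, compRing I l r = 0)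
    (k : ℕ) : ∀ l > k * d, compRing I l (r ^ k) = 0 := by
  induction k with
  | zero => simpa using compRing_one_eq_zero I
  | succ k ih =>
    rw [pow_succ, Nat.succ_mul]
    exact compRing_mul_eq_zero I ih hr

theorem compRing_prod_eq_zero {κ : Type*} (s : Finset κ) {d : κ → ℕ} {r : κ → AssocGradedRing I}
    (hr : ∀ k ∈ s, ∀ l > d k, compRing I l (r k) = 0) :
    ∀ l > ∑ k ∈ s, d k, compRing I l (∏ k ∈ s, r k) = 0 := by
  classical
  induction s using Finset.induction_on with
  | empty => simpa using compRing_one_eq_zero I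
  | insert k s hk ih =>
    rw [Finset.prod_insert hk, Finset.sum_insert hk]
    exact compRing_mul_eq_zero I (hr k (Finset.mem_insert_self k s))
      (ih fun j hj => hr j (Finset.mem_insert_of_mem hj))

theorem exists_forall_compRing_eq_zero (r : AssocGradedRing I) :
    ∃ d, ∀ l > d, compRing I l r = 0 := by
  obtain ⟨n, hn⟩ := exists_forall_eq_sum_ofRing I r
  refine ⟨n, fun l hl => ?_⟩
  rw [hn n le_rfl, map_sum]
  refine Finset.sum_eq_zero fun i hi => compRing_ofRing_ne ?_ _
  have := Finset.mem_range.1 hi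
  omega

end Ring

section Local

open IsLocalRing

variable (A : Type u) [CommRing A] [IsLocalRing A]

/-- The associated graded ring of a local ring is an algebra over the residue field. -/
instance algebraResidueField :
    Algebra (ResidueField A) (AssocGradedRing (maximalIdeal A)) :=
  RingHom.toAlgebra (Ideal.Quotient.lift (maximalIdeal A) (baseHom (maximalIdeal A))
    fun _ ha => baseHom_eq_zero _ ha)

variable {A}

theorem algebraMap_residue (a : A) :
    algebraMap (ResidueField A) (AssocGradedRing (maximalIdeal A)) (residue A a) =
      baseHom (maximalIdeal A) a := rfl

variable (A) [IsNoetherianRing A]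

instance finiteType_residueField :
    Algebra.FiniteType (ResidueField A) (AssocGradedRing (maximalIdeal A)) := by
  classical
  obtain ⟨e, x, hx⟩ := Submodule.fg_iff_exists_fin_generating_family.1
    (IsNoetherian.noetherian (maximalIdeal A))
  replace hx : Ideal.span (Set.range x) = maximalIdeal A := hx
  have hx1 : ∀ i, x i ∈ powSMul (maximalIdeal A) A 1 := fun i => by
    rw [powSMul, pow_one, smul_eq_mul, Ideal.mul_top, ← hx]
    exact Ideal.subset_span ⟨i, rfl⟩
  -- The initial forms of generators of m generate G(A) over the residue field, by induction on
  -- degree using m^(n+1) = m · m^n.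
  refine ⟨⟨Finset.univ.image fun i => ofRing (maximalIdeal A) 1 (mk _ 1 (x i) (hx1 i)), ?_⟩⟩
  set S : Subalgebra (ResidueField A) (AssocGradedRing (maximalIdeal A)) := Algebra.adjoin _ _
  have hgen : ∀ i, ofRing (maximalIdeal A) 1 (mk _ 1 (x i) (hx1 i)) ∈ S := fun i =>
    Algebra.subset_adjoin (by simp)
  have hhom : ∀ n a ha, ofRing (maximalIdeal A) n (mk _ n a ha) ∈ S := by
    intro n
    induction n with
    | zero =>
      intro a ha
      change baseHom (maximalIdeal A) a ∈ S
      rw [← algebraMap_residue]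
      exact S.algebraMap_mem _
    | succ n ih =>
      intro a ha
      have ha' := ha
      rw [powSMul, pow_succ', mul_smul] at ha'
      obtain ⟨z, hz, rfl⟩ := Submodule.exists_eq_sum_of_mem_span_range_smul hx ha'
      have hsum : ofRing (maximalIdeal A) (n + 1) (mk _ (n + 1) (∑ b, x b • z b) ha) =
          ∑ b, ofRing (maximalIdeal A) n (mk _ n (z b) (hz b)) *
            ofRing (maximalIdeal A) 1 (mk _ 1 (x b) (hx1 b)) := by
        simp only [ofRing_mul_ofRing, pieceSMul_mk]
        rw [← map_sum, mk_sum]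
        refine ofRing_mk_congr rfl (Finset.sum_congr rfl fun b _ => ?_) _ _
        rw [smul_eq_mul, smul_eq_mul, mul_comm]
      rw [hsum]
      exact sum_mem fun b _ => mul_mem (ih _ _) (hgen b)
  rw [eq_top_iff]
  intro r _
  induction r using induction_ring with
  | zero => exact zero_mem _
  | add r r' hr hr' => exact add_mem (hr trivial) (hr' trivial)
  | of n a ha => exact hhom n a ha

instance isNoetherianRing_assocGradedRing :
    IsNoetherianRing (AssocGradedRing (maximalIdeal A)) :=
  Algebra.FiniteType.isNoetherianRing (ResidueField A) _

end Local

end AssocGraded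

end

/-! ### Length estimates and the dimension of the graded ring. -/

section Length

theorem Module.length_quotient_eq_add {A : Type*} [CommRing A] {X : Type*} [AddCommGroup X]
    [Module A X] {K P : Submodule A X} (h : K ≤ P) :
    Module.length A (X ⧸ K) = Module.length A (P ⧸ K.submoduleOf P) + Module.length A (X ⧸ P) := by
  refine Module.length_eq_add_of_exact
    (Submodule.mapQ (K.submoduleOf P) K P.subtype le_rfl) (Submodule.factor h) ?_
    (Submodule.factor_surjective h) ?_
  · rw [injective_iff_map_eq_zero]
    intro z hz
    obtain ⟨z, rfl⟩ := Submodule.Quotient.mk_surjective _ z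
    exact (Submodule.Quotient.mk_eq_zero _).2 ((Submodule.Quotient.mk_eq_zero K).1 hz)
  · intro y
    obtain ⟨y, rfl⟩ := Submodule.Quotient.mk_surjective _ y
    constructor
    · intro hy
      have hy' : y ∈ P := (Submodule.Quotient.mk_eq_zero P).1 hy
      exact ⟨Submodule.Quotient.mk ⟨y, hy'⟩, rfl⟩
    · rintro ⟨z, hz⟩
      obtain ⟨z, rfl⟩ := Submodule.Quotient.mk_surjective _ z
      rw [← hz]
      exact (Submodule.Quotient.mk_eq_zero P).2 z.2

/-- Multiplication by a^n maps A/(J + (a)) onto (J + (a^n))/(J + (a^(n+1))), so each successive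
quotient costs at most one copy of that length. -/
theorem Ideal.length_quotient_sup_span_pow_le {A : Type*} [CommRing A] (J : Ideal A) (a : A)
    (n : ℕ) : Module.length A (A ⧸ (J ⊔ Ideal.span {a ^ n})) ≤
      n * Module.length A (A ⧸ (J ⊔ Ideal.span {a})) := by
  induction n with
  | zero =>
    have : Subsingleton (A ⧸ (J ⊔ Ideal.span {a ^ 0})) := by
      simp
    simp
  | succ n ih =>
    have hle : J ⊔ Ideal.span {a ^ (n + 1)} ≤ J ⊔ Ideal.span {a ^ n} :=
      sup_le_sup_left (Ideal.span_singleton_le_span_singleton.2 (pow_dvd_pow a n.le_succ)) J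
    rw [Module.length_quotient_eq_add hle, Nat.cast_succ, add_mul, one_mul, add_comm]
    refine add_le_add ih ?_
    have hmem : a ^ n ∈ J ⊔ Ideal.span {a ^ n} :=
      Ideal.mem_sup_right (Ideal.mem_span_singleton_self _)
    let f : A →ₗ[A] (J ⊔ Ideal.span {a ^ n} : Ideal A) :=
      LinearMap.toSpanSingleton A _ ⟨a ^ n, hmem⟩
    have hf : J ⊔ Ideal.span {a} ≤
        ((J ⊔ Ideal.span {a ^ (n + 1)}).submoduleOf (J ⊔ Ideal.span {a ^ n})).comap f := by
      refine sup_le (fun x hx => ?_) ((Ideal.span_singleton_le_iff_mem _).2 ?_)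
      · exact Ideal.mem_sup_left (J.mul_mem_right _ hx)
      · refine Ideal.mem_sup_right (Ideal.mem_span_singleton.2 ?_)
        rw [pow_succ']
        rfl
    refine Module.length_le_of_surjective (Submodule.mapQ _ _ f hf) fun y => ?_
    obtain ⟨⟨y, hy⟩, rfl⟩ := Submodule.Quotient.mk_surjective _ y
    obtain ⟨j, hj, b, hb, rfl⟩ := Submodule.mem_sup.1 hy
    obtain ⟨c, rfl⟩ := Ideal.mem_span_singleton'.1 hb
    refine ⟨Submodule.Quotient.mk c, ?_⟩
    rw [Submodule.mapQ_apply]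
    refine (Submodule.Quotient.eq _).2 ?_
    change c * a ^ n - (j + c * a ^ n) ∈ J ⊔ Ideal.span {a ^ (n + 1)}
    rw [sub_add_cancel_right]
    exact Ideal.mem_sup_left (neg_mem hj)

end Length

theorem ringKrullDim_le_of_isIntegral {R S : Type*} [CommRing R] [CommRing S] (f : R →+* S)
    (hf : f.IsIntegral) : ringKrullDim S ≤ ringKrullDim R := by
  let := f.toAlgebra
  have : Algebra.IsIntegral R S := ⟨hf⟩
  exact Order.krullDim_le_of_strictMono (PrimeSpectrum.comap (algebraMap R S)) fun p q hpq =>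
    Ideal.IsIntegral.comap_lt_comap hpq

namespace AssocGraded

open IsLocalRing

theorem sum_length_piece {A : Type u} [CommRing A] (I : Ideal A) (n : ℕ) :
    ∑ l : Fin n, Module.length A (Piece I A l) = Module.length A (A ⧸ powSMul I A n) := by
  induction n with
  | zero =>
    have : Subsingleton (A ⧸ powSMul I A 0) := by
      rw [Submodule.Quotient.subsingleton_iff]
      exact eq_top_iff.2 fun x _ => mem_powSMul_zero x
    simp
  | succ n ih =>
    rw [Fin.sum_univ_castSucc, Module.length_quotient_eq_add
      (Submodule.pow_smul_top_le I A n.le_succ), add_comm]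
    exact congrArg _ ih

variable (A : Type u) [CommRing A] [IsLocalRing A]

/-- The left side is the length of A/m^n, and (x^n, y^n) ⊆ m^n; removing the two exponents in turn
costs a factor n each. -/
theorem sum_length_piece_le {x y : A} (hx : x ∈ maximalIdeal A) (hy : y ∈ maximalIdeal A)
    (n : ℕ) : ∑ l : Fin n, Module.length A (Piece (maximalIdeal A) A l) ≤
      n * (n * Module.length A (A ⧸ (Ideal.span {x} ⊔ Ideal.span {y}))) := by
  rw [sum_length_piece]
  have hle : Ideal.span {x ^ n} ⊔ Ideal.span {y ^ n} ≤ powSMul (maximalIdeal A) A n := by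
    rw [powSMul, smul_eq_mul, Ideal.mul_top]
    refine sup_le ?_ ?_ <;> rw [Ideal.span_singleton_le_iff_mem]
    exacts [Ideal.pow_mem_pow hx n, Ideal.pow_mem_pow hy n]
  refine (Module.length_le_of_surjective _ (Submodule.factor_surjective hle)).trans ?_
  refine (Ideal.length_quotient_sup_span_pow_le _ y n).trans ?_
  gcongr
  rw [sup_comm, sup_comm (Ideal.span {x})]
  exact Ideal.length_quotient_sup_span_pow_le _ x n

/-- Linearly independent elements of bounded degree are bounded in number by the length of
a truncation of the associated graded ring. -/
theorem card_le_sum_length_piece {κ : Type*} [Fintype κ]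
    {v : κ → AssocGradedRing (maximalIdeal A)} (hv : LinearIndependent (ResidueField A) v)
    {n : ℕ} (hn : ∀ k, ∀ l ≥ n, compRing _ l (v k) = 0) :
    (Fintype.card κ : ℕ∞) ≤ ∑ l : Fin n, Module.length A (Piece (maximalIdeal A) A l) := by
  have hsimple : IsSimpleModule A (ResidueField A) :=
    isSimpleModule_iff_quot_maximal.2 ⟨maximalIdeal A, inferInstance, ⟨LinearEquiv.refl A _⟩⟩
  -- Taking the components of degree below n loses nothing on the span of v, so the length of the
  -- source, which is the cardinality of κ, is bounded by that of the truncation.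
  let Ψ : (κ → ResidueField A) →ₗ[A] (∀ l : Fin n, Piece (maximalIdeal A) A l) :=
    { toFun := fun c l => compRing _ l (∑ k, c k • v k)
      map_add' := fun c c' => by
        funext l
        simp [add_smul, Finset.sum_add_distrib]
      map_smul' := fun a c => by
        funext l
        simp only [Pi.smul_apply, RingHom.id_apply]
        rw [← compRing_baseHom_mul, Finset.mul_sum, ← algebraMap_residue]
        congr 1
        refine Finset.sum_congr rfl fun k _ => ?_
        rw [Algebra.smul_def a, ResidueField.algebraMap_eq, mul_smul, Algebra.smul_def] }
  have hΨ : Function.Injective Ψ := by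
    rw [injective_iff_map_eq_zero]
    intro c hc
    refine funext (Fintype.linearIndependent_iff.1 hv c (ext_compRing fun l => ?_))
    by_cases hl : l < n
    · rw [map_zero]
      exact congrFun hc ⟨l, hl⟩
    · rw [map_sum, map_zero]
      refine Finset.sum_eq_zero fun k _ => ?_
      obtain ⟨a, ha⟩ := residue_surjective (c k)
      rw [← ha, Algebra.smul_def, algebraMap_residue, compRing_baseHom_mul,
        hn k l (not_lt.1 hl), smul_zero]
  have := Module.length_le_of_injective Ψ hΨ
  rw [Module.length_pi_of_fintype A fun l : Fin n => Piece (maximalIdeal A) A l] at this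
  simpa using this

/-- Growth comparison: the N^s monomials with exponents below N have independent images of degree at
most ND, where D adds up degree bounds for the images of the variables. Hence N^s ≤ (ND + 1)² L,
which fails for s ≥ 3 and N large. -/
theorem le_two_of_injective [IsNoetherianRing A] {x y : A} (hx : x ∈ maximalIdeal A)
    (hy : y ∈ maximalIdeal A)
    (hxy : Module.length A (A ⧸ (Ideal.span {x} ⊔ Ideal.span {y})) ≠ ⊤) {s : ℕ}
    (φ : MvPolynomial (Fin s) (ResidueField A) →ₐ[ResidueField A]
      AssocGradedRing (maximalIdeal A)) (hφ : Function.Injective φ) : s ≤ 2 := by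
  by_contra! hs
  obtain ⟨L, hL⟩ := ENat.ne_top_iff_exists.1 hxy
  choose d hd using fun i => exists_forall_compRing_eq_zero _ (φ (MvPolynomial.X i))
  set D := ∑ i, d i
  have hbound : ∀ N : ℕ, N ^ s ≤ (N * D + 1) * ((N * D + 1) * L) := by
    intro N
    have hv : LinearIndependent (ResidueField A) fun e : Fin s → Fin N =>
        φ (MvPolynomial.monomial (Finsupp.equivFunOnFinite.symm fun i => (e i : ℕ)) 1) := by
      refine LinearIndependent.map' (v := fun e : Fin s → Fin N =>
        MvPolynomial.monomial (R := ResidueField A)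
          (Finsupp.equivFunOnFinite.symm fun i => (e i : ℕ)) 1) ?_ φ.toLinearMap
          (LinearMap.ker_eq_bot.2 hφ)
      have := (MvPolynomial.basisMonomials (Fin s) (ResidueField A)).linearIndependent
      rw [MvPolynomial.coe_basisMonomials] at this
      refine this.comp (fun e : Fin s → Fin N =>
        Finsupp.equivFunOnFinite.symm fun i => (e i : ℕ)) fun e e' h => ?_
      funext i
      exact Fin.ext (congrFun (Finsupp.equivFunOnFinite.symm.injective h) i)
    have hcard := (card_le_sum_length_piece A hv (n := N * D + 1) fun e l hl => by
      rw [MvPolynomial.monomial_eq, map_one, one_mul, Finsupp.prod_fintype _ _ (by simp), map_prod]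
      simp only [map_pow]
      refine compRing_prod_eq_zero _ _ (d := fun i => (e i : ℕ) * d i)
        (fun i _ => compRing_pow_eq_zero _ (hd i) _) l ?_
      refine lt_of_le_of_lt ?_ hl
      rw [Finset.mul_sum]
      exact Finset.sum_le_sum fun i _ => Nat.mul_le_mul_right _ (e i).2.le).trans
        (sum_length_piece_le A hx hy _)
    rw [← hL] at hcard
    have : Fintype.card (Fin s → Fin N) ≤ (N * D + 1) * ((N * D + 1) * L) := by
      exact_mod_cast hcard
    simpa using this
  -- With N > (D + 1)² L one has (ND + 1)² L ≤ N² (D + 1)² L < N³.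
  have h := hbound ((D + 1) * (D + 1) * L + 1)
  set N := (D + 1) * (D + 1) * L + 1 with hN
  have hN1 : 1 ≤ N := by omega
  have h1 : N * D + 1 ≤ N * (D + 1) := by rw [mul_add, mul_one]; omega
  have h2 : (N * D + 1) * ((N * D + 1) * L) ≤ N * N * ((D + 1) * (D + 1) * L) :=
    calc _ ≤ (N * (D + 1)) * ((N * (D + 1)) * L) := by gcongr
      _ = _ := by ring
  have h3 : N ^ 3 ≤ N ^ s := Nat.pow_le_pow_right hN1 hs
  have h4 : N * N * ((D + 1) * (D + 1) * L) < N * N * N :=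
    Nat.mul_lt_mul_of_pos_left (by omega) (by positivity)
  have h5 : N ^ 3 = N * N * N := by ring
  omega

theorem ringKrullDim_le_two [IsNoetherianRing A] [Nontrivial (AssocGradedRing (maximalIdeal A))]
    {x y : A} (hx : x ∈ maximalIdeal A) (hy : y ∈ maximalIdeal A)
    (hxy : Module.length A (A ⧸ (Ideal.span {x} ⊔ Ideal.span {y})) ≠ ⊤) :
    ringKrullDim (AssocGradedRing (maximalIdeal A)) ≤ 2 := by
  obtain ⟨s, φ, hφ, hint⟩ := exists_integral_inj_algHom_of_fg (ResidueField A)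
    (AssocGradedRing (maximalIdeal A))
  refine (ringKrullDim_le_of_isIntegral _ hint).trans ?_
  rw [MvPolynomial.ringKrullDim_of_isNoetherianRing, ringKrullDim_eq_zero_of_field, zero_add,
    Nat.card_fin]
  exact_mod_cast le_two_of_injective A hx hy hxy φ hφ

end AssocGraded

/-! ### Vanishing of Ext¹(M, M) at P and lifting of maps. -/

section Ext

open CategoryTheory Abelian

/-- If `p` is not in the support of `Ext¹(M, M)`, where `M` is the kernel of a surjection
`π : F → N`, then every map `M → N` lifts to `F` up to a multiple by an element outside `p`. -/
theorem exists_smul_lift_of_notMem_support_ext {A : Type u} [CommRing A] {F N : Type u}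
    [AddCommGroup F] [Module A F] [AddCommGroup N] [Module A N] (π : F →ₗ[A] N)
    (hπ : Function.Surjective π) (p : PrimeSpectrum A)
    (hp : p ∉ Module.support A (Ext (ModuleCat.of A (LinearMap.ker π))
      (ModuleCat.of A (LinearMap.ker π)) 1)) (φ : LinearMap.ker π →ₗ[A] N) :
    ∃ c ∉ p.asIdeal, ∃ Φ : LinearMap.ker π →ₗ[A] F, π ∘ₗ Φ = c • φ := by
  let S : ShortComplex (ModuleCat.{u} A) := ShortComplex.mk
    (ModuleCat.ofHom (LinearMap.ker π).subtype) (ModuleCat.ofHom π)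
    (by ext x; exact x.2)
  have hS : S.ShortExact :=
    { exact := (ShortComplex.ShortExact.moduleCat_exact_iff_function_exact S).2
        (LinearMap.exact_subtype_ker_map π)
      mono_f := (ModuleCat.mono_iff_injective _).2 (Submodule.subtype_injective _)
      epi_g := (ModuleCat.epi_iff_surjective _).2 hπ }
  let f : ModuleCat.of A (LinearMap.ker π) ⟶ S.X₃ := ModuleCat.ofHom φ
  -- The obstruction to lifting φ is the composite of φ with the class of 0 → ker π → F → N → 0, an
  -- element of Ext¹(ker π, ker π). Some c outside p kills it, so cφ lifts.
  obtain ⟨c, hc, hce⟩ := Module.notMem_support_iff'.1 hp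
    ((Ext.mk₀ f).comp hS.extClass (zero_add 1))
  rw [← Ext.smul_comp, ← Ext.mk₀_smul] at hce
  obtain ⟨x, hx⟩ := Ext.covariant_sequence_exact₃ _ hS _ _ hce
  rw [← Ext.mk₀_homEquiv₀_apply x, Ext.mk₀_comp_mk₀] at hx
  exact ⟨c, hc, (Ext.homEquiv₀ x).hom,
    congrArg ModuleCat.Hom.hom ((Ext.mk₀_bijective _ _).1 hx)⟩

/-- Let `M` be the syzygy module of generators of a nonzero ideal of `A / P`. If `P` is not in the
support of `Ext¹(M, M)`, then every nonzero map `P → A / P` yields a map `P → A` whose image is not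
contained in `P`. -/
theorem exists_apply_notMem_of_notMem_support_ext {A : Type u} [CommRing A] (P : Ideal A)
    [hP : P.IsPrime] (Q : Submodule A (A ⧸ P)) (hQ : Q ≠ ⊥) {s : ℕ} (g : Fin s → Q)
    (hg : Submodule.span A (Set.range g) = ⊤)
    (h : (⟨P, hP⟩ : PrimeSpectrum A) ∉ Module.support A
      (Ext (ModuleCat.of A (LinearMap.ker (Fintype.linearCombination A g)))
        (ModuleCat.of A (LinearMap.ker (Fintype.linearCombination A g))) 1))
    (l : P →ₗ[A] A ⧸ P) (p : P) (hl : l p ≠ 0) : ∃ θ : P →ₗ[A] A, θ p ∉ P := by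
  have hsurj : Function.Surjective (Fintype.linearCombination A g) := by
    rw [← LinearMap.range_eq_top, Fintype.range_linearCombination, hg]
  obtain ⟨k, hk⟩ : ∃ k, g k ≠ 0 := by
    by_contra! hcon
    refine hQ (Submodule.subsingleton_iff_eq_bot.1 ?_)
    rw [← Submodule.subsingleton_iff A, ← subsingleton_iff_bot_eq_top, ← hg, eq_comm,
      Submodule.span_eq_bot]
    rintro _ ⟨i, rfl⟩
    exact hcon i
  choose b hb using fun i => Ideal.Quotient.mk_surjective (g i : A ⧸ P)
  have hbk : b k ∉ P := fun hmem => hk (Subtype.ext (by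
    rw [← hb k, Ideal.Quotient.eq_zero_iff_mem.2 hmem]; rfl))
  have hmk : ∀ a : Fin s → A, Ideal.Quotient.mk P (∑ i, a i * b i) =
      (Fintype.linearCombination A g a : Q) := fun a => by
    rw [Fintype.linearCombination_apply, map_sum, AddSubmonoidClass.coe_finsetSum]
    refine Finset.sum_congr rfl fun i _ => ?_
    rw [map_mul, hb]
    rfl
  have hPQ : ∀ a ∈ P, ∀ q : Q, a • q = 0 := fun a ha q => Subtype.ext (by
    obtain ⟨c, hc⟩ := Ideal.Quotient.mk_surjective (q : A ⧸ P)
    rw [Submodule.coe_smul, ← hc]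
    exact Ideal.Quotient.eq_zero_iff_mem.2 (P.mul_mem_right c ha))
  -- σ and τ compare M with P before localizing: σ evaluates a relation on lifts b_i of the
  -- generators, τ places an element of P in coordinate k, and σ ∘ τ is multiplication by b_k, which
  -- lies outside P.
  let σ : LinearMap.ker (Fintype.linearCombination A g) →ₗ[A] P :=
    { toFun := fun a => ⟨∑ i, (a : Fin s → A) i * b i, by
        rw [← Ideal.Quotient.eq_zero_iff_mem, hmk, a.2]; rfl⟩
      map_add' := fun a a' => Subtype.ext (by simp [add_mul, Finset.sum_add_distrib])
      map_smul' := fun c a => Subtype.ext (by simp [mul_assoc, Finset.mul_sum]) }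
  let τ : P →ₗ[A] LinearMap.ker (Fintype.linearCombination A g) :=
    (LinearMap.single A (fun _ => A) k ∘ₗ P.subtype).codRestrict _ fun q => by
      rw [LinearMap.mem_ker]
      simp [hPQ q q.2]
  have hτ : ∀ q, σ (τ q) = b k • q := fun q => Subtype.ext (by
    change ∑ i, (Pi.single k (q : A) : Fin s → A) i * b i = b k * q
    rw [Finset.sum_eq_single k (fun i _ hi => by simp [hi]) (by simp)]
    simp [mul_comm])
  let κ : (A ⧸ P) →ₗ[A] Q := Submodule.liftQ P (LinearMap.toSpanSingleton A Q (g k))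
    fun a ha => hPQ a ha _
  have hκ : ∀ y, (κ y : A ⧸ P) = y * g k := fun y => by
    obtain ⟨y, rfl⟩ := Ideal.Quotient.mk_surjective y
    rfl
  obtain ⟨c, hc, Φ, hΦ⟩ := exists_smul_lift_of_notMem_support_ext _ hsurj _ h (κ ∘ₗ l ∘ₗ σ)
  refine ⟨Fintype.linearCombination A b ∘ₗ Φ ∘ₗ τ, ?_⟩
  rw [← Ideal.Quotient.eq_zero_iff_mem]
  -- Modulo P the value is c b_k² l(p): one b_k comes from σ ∘ τ, the other from embedding A/P in Q
  -- through g_k. It is nonzero because A/P is a domain.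
  have h1 : Ideal.Quotient.mk P ((Fintype.linearCombination A b ∘ₗ Φ ∘ₗ τ) p) =
      Ideal.Quotient.mk P c * (Ideal.Quotient.mk P (b k) * l p * Ideal.Quotient.mk P (b k)) := by
    have h2 := congrArg (Subtype.val : Q → A ⧸ P) (LinearMap.congr_fun hΦ (τ p))
    simp only [LinearMap.comp_apply, LinearMap.smul_apply, hτ, map_smul, Submodule.coe_smul,
      hκ] at h2
    simp only [LinearMap.comp_apply]
    rw [Fintype.linearCombination_apply]
    simp only [smul_eq_mul]
    rw [hmk, h2, ← hb k, Algebra.smul_def, Algebra.smul_def, Ideal.Quotient.algebraMap_eq,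
      mul_assoc]
  rw [h1]
  have hc' : Ideal.Quotient.mk P c ≠ 0 := fun h0 => hc (Ideal.Quotient.eq_zero_iff_mem.1 h0)
  have hb' : Ideal.Quotient.mk P (b k) ≠ 0 := fun h0 => hbk (Ideal.Quotient.eq_zero_iff_mem.1 h0)
  exact mul_ne_zero hc' (mul_ne_zero (mul_ne_zero hb' hl) hb')

end Ext

/-! ### Criteria for regularity of A_P. -/

section Regular

open IsLocalRing

variable {A : Type*} [CommRing A] (P : Ideal A) [P.IsPrime]

theorem isRegularLocalRing_of_forall_smul_eq_zero {r : A} (hr : r ∉ P) (h : ∀ a ∈ P, r * a = 0) :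
    IsRegularLocalRing (Localization.AtPrime P) := by
  have hmax : maximalIdeal (Localization.AtPrime P) = ⊥ := by
    rw [← Localization.AtPrime.map_eq_maximalIdeal, eq_bot_iff, Ideal.map_le_iff_le_comap]
    intro a ha
    rw [Ideal.mem_comap, Ideal.mem_bot]
    exact (IsLocalization.map_eq_zero_iff P.primeCompl _ a).2 ⟨⟨r, hr⟩, h a ha⟩
  let : Field (Localization.AtPrime P) := (isField_iff_maximalIdeal_eq.2 hmax).toField
  infer_instance

/-- Linearity gives θ(p)w = pθ(w) for w in P. As θ(p) becomes a unit, p generates PA_P; and ap = 0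
forces aθ(p) = 0, so p is a nonzerodivisor there. Thus the embedding dimension is at most 1, while
the dimension is at least 1. -/
theorem isRegularLocalRing_of_linearMap_apply_notMem [IsNoetherianRing A] (θ : P →ₗ[A] A) (p : P)
    (h : θ p ∉ P) : IsRegularLocalRing (Localization.AtPrime P) := by
  have hcomm : ∀ w : P, θ p * w = p * θ w := fun w => by
    rw [mul_comm, ← smul_eq_mul, ← map_smul, ← smul_eq_mul, ← map_smul]
    congr 1
    exact Subtype.ext (mul_comm _ _)
  set t := algebraMap A (Localization.AtPrime P) p
  have hunit : IsUnit (algebraMap A (Localization.AtPrime P) (θ p)) :=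
    IsLocalization.map_units _ (⟨θ p, h⟩ : P.primeCompl)
  have hmax : maximalIdeal (Localization.AtPrime P) = Ideal.span {t} := by
    rw [← Localization.AtPrime.map_eq_maximalIdeal]
    refine le_antisymm (Ideal.map_le_iff_le_comap.2 fun w hw => ?_)
      ((Ideal.span_singleton_le_iff_mem _).2 (Ideal.mem_map_of_mem _ p.2))
    rw [Ideal.mem_comap, Ideal.mem_span_singleton, ← hunit.dvd_mul_left, ← map_mul,
      hcomm ⟨w, hw⟩, map_mul]
    exact dvd_mul_right _ _
  have htm : t ∈ maximalIdeal (Localization.AtPrime P) := by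
    rw [hmax]
    exact Ideal.mem_span_singleton_self t
  have hreg : IsSMulRegular (Localization.AtPrime P) t := by
    refine IsSMulRegular.of_right_eq_zero_of_smul fun x hx => ?_
    obtain ⟨a, d, rfl⟩ := IsLocalization.exists_mk'_eq P.primeCompl x
    rw [smul_eq_mul, IsLocalization.mul_mk'_eq_mk'_of_mul, IsLocalization.mk'_eq_zero_iff] at hx
    obtain ⟨c, hc⟩ := hx
    rw [IsLocalization.mk'_eq_zero_iff]
    refine ⟨c * ⟨θ p, h⟩, ?_⟩
    have h0 : ((c : A) * a) • p = 0 := Subtype.ext (by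
      rw [Submodule.coe_smul, smul_eq_mul, mul_assoc, mul_comm a, hc]; rfl)
    have := congrArg θ h0
    rw [map_smul, map_zero, smul_eq_mul] at this
    rw [Submonoid.coe_mul, mul_assoc, mul_comm (θ p), ← mul_assoc, this]
  refine IsRegularLocalRing.of_spanFinrank_maximalIdeal_le _ ?_
  have h1 : (maximalIdeal (Localization.AtPrime P)).spanFinrank ≤ 1 := by
    rw [hmax, ← Set.ncard_singleton t]
    exact Submodule.spanFinrank_span_le_ncard_of_finite (Set.finite_singleton t)
  have : Nontrivial (Localization.AtPrime P ⧸ Ideal.span {t}) :=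
    Ideal.Quotient.nontrivial_iff.2 (hmax ▸ Ideal.IsPrime.ne_top')
  rw [← ringKrullDim_quotient_span_singleton_succ_eq_ringKrullDim hreg htm]
  refine le_trans (by exact_mod_cast h1 : _ ≤ (0 + 1 : WithBot ℕ∞)) ?_
  gcongr
  exact ringKrullDim_nonneg_of_nontrivial

end Regular

open CategoryTheory Abelian in
/-- Let `M` be the syzygy module of generators of a nonzero ideal of `A / P`. If `A_P` is not
regular, then `P` is in the support of `Ext¹(M, M)`. -/
theorem mem_support_ext_of_not_isRegularLocalRing {A : Type u} [CommRing A] [IsNoetherianRing A]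
    (P : Ideal A) [hP : P.IsPrime] (hreg : ¬ IsRegularLocalRing (Localization.AtPrime P))
    (Q : Submodule A (A ⧸ P)) (hQ : Q ≠ ⊥) {s : ℕ} (g : Fin s → Q)
    (hg : Submodule.span A (Set.range g) = ⊤) :
    (⟨P, hP⟩ : PrimeSpectrum A) ∈ Module.support A
      (Ext (ModuleCat.of A (LinearMap.ker (Fintype.linearCombination A g)))
        (ModuleCat.of A (LinearMap.ker (Fintype.linearCombination A g))) 1) := by
  by_contra h
  by_cases hl : ∃ (l : P →ₗ[A] A ⧸ P) (p : P), l p ≠ 0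
  · obtain ⟨l, p, hlp⟩ := hl
    obtain ⟨θ, hθ⟩ := exists_apply_notMem_of_notMem_support_ext P Q hQ g hg h l p hlp
    exact hreg (isRegularLocalRing_of_linearMap_apply_notMem P θ p hθ)
  · push Not at hl
    have : Subsingleton (P →ₗ[A] A ⧸ P) :=
      subsingleton_of_forall_eq 0 fun l => LinearMap.ext (hl l)
    -- Hom(P, A/P) = 0 gives an r that annihilates P and is regular on A/P, hence lies outside P;
    -- then PA_P = 0.
    obtain ⟨r, hr, hrr⟩ := IsSMulRegular.subsingleton_linearMap_iff.1 this
    refine hreg (isRegularLocalRing_of_forall_smul_eq_zero P (r := r) (fun hrP => ?_) fun a ha =>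
      congrArg Subtype.val (Module.mem_annihilator.1 hr ⟨a, ha⟩))
    have h1 : (1 : A ⧸ P) = 0 := hrr.right_eq_zero_of_smul (by
      rw [Algebra.smul_def, mul_one]
      exact Ideal.Quotient.eq_zero_iff_mem.2 hrP)
    exact one_ne_zero h1

open CategoryTheory Abelian in
-- If M were zero its identity would be zero and so would every Ext class; this supplies the M ≠ 0
-- that the depth computation needs.
theorem nontrivial_of_mem_support_ext {A : Type u} [CommRing A] {M : Type u} [AddCommGroup M]
    [Module A M] {p : PrimeSpectrum A}
    (hp : p ∈ Module.support A (Ext (ModuleCat.of A M) (ModuleCat.of A M) 1)) : Nontrivial M := by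
  by_contra h
  have := not_nontrivial_iff_subsingleton.1 h
  obtain ⟨e, he⟩ := Module.mem_support_iff'.1 hp
  refine he 1 p.2.one_notMem ?_
  have hid : 𝟙 (ModuleCat.of A M) = 0 := by
    ext x
    exact Subsingleton.elim (α := M) _ _
  rw [one_smul, ← Ext.mk₀_id_comp e, hid, Ext.mk₀_zero, Ext.zero_comp]

theorem one_le_supportDim_of_mem_support {A : Type*} [CommRing A] {M : Type*} [AddCommGroup M]
    [Module A M] {p q : PrimeSpectrum A} (hp : p ∈ Module.support A M) (hpq : p < q) :
    1 ≤ Module.supportDim A M := by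
  have hq := Module.mem_support_mono hpq.le hp
  exact Order.one_le_krullDim_iff.2 ⟨⟨p, hp⟩, ⟨q, hq⟩, hpq⟩

/-! ### Assembly of the construction. -/

open IsLocalRing RingTheory.Sequence in
-- A regular sequence x, y of length two exists by Cohen-Macaulayness; A/(x, y) then has dimension
-- zero, so it is Artinian and of finite length.
theorem AssocGraded.ringKrullDim_assocGradedRing_le_two {A : Type u} [CommRing A] [IsLocalRing A]
    [IsNoetherianRing A] (hdim : ringKrullDim A = 2) (hCM : IsLocalCohenMacaulay A A) :
    ringKrullDim (AssocGradedRing (maximalIdeal A)) ≤ 2 := by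
  cases subsingleton_or_nontrivial (AssocGradedRing (maximalIdeal A))
  · rw [ringKrullDim_eq_bot_of_subsingleton]
    exact bot_le
  have hd := hCM inferInstance
  rw [Module.supportDim_self_eq_ringKrullDim, hdim] at hd
  have hd' : localDepth A A = (2 : ℕ) := WithBot.coe_injective hd
  obtain ⟨rs, hrs, hreg, hlen⟩ := exists_isRegular_length_of_localDepth_eq hd'
  obtain ⟨x, y, rfl⟩ := List.length_eq_two.1 hlen
  refine AssocGraded.ringKrullDim_le_two A (hrs x (by simp)) (hrs y (by simp)) ?_
  have h := ringKrullDim_add_length_eq_ringKrullDim_of_isRegular _ hreg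
  rw [show Ideal.ofList [x, y] = Ideal.span {x} ⊔ Ideal.span {y} by simp, hdim, hlen] at h
  set J := Ideal.span {x} ⊔ Ideal.span {y}
  have h0 : ringKrullDim (A ⧸ J) ≤ 0 := by
    cases hJ : ringKrullDim (A ⧸ J) with
    | bot => exact bot_le
    | coe e =>
      rw [hJ] at h
      have h' : e + 2 = 0 + 2 := WithBot.coe_injective h
      rw [ENat.add_left_injective_of_ne_top (ENat.natCast_ne_top 2) h']
      rfl
  have : Ring.KrullDimLE 0 (A ⧸ J) := by
    rw [Ring.krullDimLE_iff]
    exact_mod_cast h0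
  have : IsArtinianRing (A ⧸ J) := IsNoetherianRing.isArtinianRing_of_krullDimLE_zero
  have hart : IsArtinian A (A ⧸ J) :=
    isArtinian_of_surjective_algebraMap (R := A ⧸ J) Ideal.Quotient.mk_surjective
  exact Module.length_ne_top

theorem proposition9 {A : Type u} [CommRing A] [IsLocalRing A] [IsNoetherianRing A]
    (hdim : ringKrullDim A = 2) (hCM : IsLocalCohenMacaulay A A)
    (hG : IsCohenMacaulay (AssocGradedRing (IsLocalRing.maximalIdeal A))
      (AssocGradedRing (IsLocalRing.maximalIdeal A)))
    (hsing : ¬ IsIsolatedSingularity A) :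
    ∃ M : ModuleCat.{u} A, IsMaximalCohenMacaulay A M ∧
      IsCohenMacaulay (AssocGradedRing (IsLocalRing.maximalIdeal A))
        (AssocGradedModule (IsLocalRing.maximalIdeal A) M) ∧
      1 ≤ Module.supportDim A (CategoryTheory.Abelian.Ext M M 1) := by
  obtain ⟨P, hP, hPm, hreg⟩ : ∃ (P : Ideal A) (_ : P.IsPrime), P ≠ IsLocalRing.maximalIdeal A ∧
      ¬ IsRegularLocalRing (Localization.AtPrime P) := by
    by_contra! hcon
    exact hsing fun p hp hpm => hcon p hp hpm
  set m := IsLocalRing.maximalIdeal A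
  have hPlt : P < m := lt_of_le_of_ne (IsLocalRing.le_maximalIdeal hP.ne_top) hPm
  obtain ⟨a, ham, haP⟩ := SetLike.exists_of_lt hPlt
  obtain ⟨n₁, hn₁⟩ := Ideal.exists_forall_mem_pow_succ_smul_of_forall_smul_mem m (A ⧸ P)
  obtain ⟨n₂, hn₂⟩ := Ideal.exists_forall_ker_inf_pow_succ_eq.{u} m (A ⧸ P)
  -- Beyond n₁ the graded module of A/P has no socle; beyond n₂ the relations of m^n(A/P) are
  -- controlled.
  set n := max n₁ n₂
  let Q : Submodule A (A ⧸ P) := m ^ n • ⊤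
  have hareg : ∀ y : A ⧸ P, a • y = 0 → y = 0 := fun y hy => by
    rw [Algebra.smul_def, mul_eq_zero] at hy
    exact hy.resolve_left fun h => haP (Ideal.Quotient.eq_zero_iff_mem.1 h)
  have hQ : Q ≠ ⊥ := fun hbot => by
    have hmem : a ^ n • (1 : A ⧸ P) ∈ Q :=
      Submodule.smul_mem_smul (Ideal.pow_mem_pow ham n) trivial
    rw [hbot, Submodule.mem_bot, Algebra.smul_def, mul_one] at hmem
    exact haP (hP.mem_of_pow_mem n (Ideal.Quotient.eq_zero_iff_mem.1 hmem))
  obtain ⟨s, g, hg, hmin⟩ := IsLocalRing.exists_minimal_generating_family A Q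
  have hsurj : Function.Surjective (Fintype.linearCombination A g) := by
    rw [← LinearMap.range_eq_top, Fintype.range_linearCombination, hg]
  have hkerle : LinearMap.ker (Fintype.linearCombination A g) ≤ m • ⊤ := fun c hc =>
    Submodule.mem_smul_top_pi fun i => by
      rw [smul_eq_mul, Ideal.mul_top]
      exact hmin c (by rw [← Fintype.linearCombination_apply]; exact hc) i
  have H : ∀ j, LinearMap.ker (Fintype.linearCombination A g) ⊓ m ^ (j + 1) • ⊤ =
      m ^ j • LinearMap.ker (Fintype.linearCombination A g) := by
    have hker : LinearMap.ker (Q.subtype ∘ₗ Fintype.linearCombination A g) =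
        LinearMap.ker (Fintype.linearCombination A g) :=
      LinearMap.ker_comp_of_ker_eq_bot _ Q.ker_subtype
    have hrange : LinearMap.range (Q.subtype ∘ₗ Fintype.linearCombination A g) = m ^ n • ⊤ := by
      rw [LinearMap.range_comp, LinearMap.range_eq_top.2 hsurj, Submodule.map_top,
        Submodule.range_subtype]
    rw [← hker]
    exact hn₂ n (le_max_right _ _) (Fin s → A) _ hrange (hker ▸ hkerle)
  -- The m-adic filtration of Q is that of A/P shifted by n, so the high-degree socle statement for
  -- A/P covers every degree of G(Q).
  have hpow : ∀ j (u : Q), u ∈ AssocGraded.powSMul m Q j ↔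
      (u : A ⧸ P) ∈ m ^ (j + n) • (⊤ : Submodule A (A ⧸ P)) := fun j u => by
    rw [AssocGraded.powSMul, Submodule.mem_smul_top_iff, pow_add, mul_smul]
  have hsocle : ∀ j, ∀ u ∈ AssocGraded.powSMul m Q j,
      (∀ b ∈ m, b • u ∈ AssocGraded.powSMul m Q (j + 2)) → u ∈ AssocGraded.powSMul m Q (j + 1) := by
    intro j u hu hub
    rw [hpow] at hu ⊢
    rw [add_right_comm]
    refine hn₁ (j + n) (le_add_left (le_max_left _ _)) _ hu fun b hb => ?_
    rw [add_right_comm]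
    exact (hpow _ _).1 (hub b hb)
  have hExt := mem_support_ext_of_not_isRegularLocalRing P hreg Q hQ g hg
  have hnt := nontrivial_of_mem_support_ext hExt
  obtain ⟨hdepth, hsupp⟩ := localDepth_and_supportDim_of_syzygy hCM hdim.le
    (LinearMap.ker (Fintype.linearCombination A g)).subtype (Fintype.linearCombination A g)
    (Submodule.subtype_injective _) (LinearMap.exact_subtype_ker_map _) hsurj
    fun q hq => Subtype.ext (hareg q (congrArg Subtype.val (hq a ham)))
  refine ⟨ModuleCat.of A (LinearMap.ker (Fintype.linearCombination A g)),
    ⟨inferInstanceAs (Module.Finite A (LinearMap.ker (Fintype.linearCombination A g))),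
      fun _ => hdepth.trans hsupp.symm, hsupp⟩, ?_, ?_⟩
  · exact hG.of_syzygy (AssocGraded.ringKrullDim_assocGradedRing_le_two hdim hCM)
      (AssocGraded.syzygyMap g H) (AssocGraded.generatorMap m g)
      (AssocGraded.syzygyMap_injective H) (AssocGraded.exact_syzygyMap_generatorMap hg H)
      (AssocGraded.generatorMap_surjective hg)
      (AssocGraded.eq_zero_of_forall_mem_isMaximal_smul_eq_zero hsocle)
  · exact one_le_supportDim_of_mem_support
      (q := ⟨m, (IsLocalRing.maximalIdeal.isMaximal A).isPrime⟩) hExt hPlt
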